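/- Let $\Gamma=\mathrm{SL}(2,\mathbb Z)$ and $\mathcal X=\Gamma\backslash\mathrm{SL}(2,\mathbb R)$, with the geodesic flow $\varphi_t(x)=x\begin{pmatrix}e^{t/2}&0\\0&e^{-t/2}\end{pmatrix}$, the unstable horocycle flow $h^+_s(x)=x\begin{pmatrix}1&0\\-s&1\end{pmatrix}$ and the stable horocycle flow $h^-_s(x)=x\begin{pmatrix}1&s\\0&1\end{pmatrix}$. Let $x_\infty=\Gamma\cdot 1$, let $\mathcal C=\{h^-_s(x_\infty):s\in\mathbb R\}$ be the closed stable horocycle of length one around the cusp, and let $\mathcal H=\bigcup_{t\ge 0}\varphi_t(\mathcal C)$ be the corresponding Poincaré section for $h^+$, parametrised by $\iota(s,t)=\varphi_t(h^-_s(x_\infty))$ with $(s,t)\in\Sigma=[0,1)\times[0,\infty)$. For $w\in\Sigma$ let $$\eta_{1}(w)=\inf\{r>0: h^+_{r}(\iota(w))\in\mathcal H\},\qquad \eta_{-1}(w)=\inf\{r>0: h^+_{-r}(\iota(w))\in\mathcal H\}$$ be the forward and backward return times, put $d\nu(s,t)=e^{-t}\,dt\,ds$ and $\overline\eta_1=\int_\Sigma\eta_1\,d\nu$,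 and define the hitting time density and the extreme value density by $$\Psi(r)=\frac1{\overline\eta_1}\int_\Sigma \mathbf 1\big(r<\eta_{-1}(w)\big)\,d\nu(w)\quad(r\ge 0),\qquad \rho(s)=e^{-s}\,\Psi(e^{-s})\quad(s\in\mathbb R).$$ Then: 1. $$\Psi(r)=\frac3{\pi^2}\times\begin{cases}1&\text{if } r\in[0,1),\\ -1+2r^{-1}+2r^{-1}\log r&\text{if } r\in[1,4],\\ -1+2r^{-1}+2\sqrt{\tfrac14-r^{-1}}-4r^{-1}\log\Big(\tfrac12+\sqrt{\tfrac14-r^{-1}}\Big)&\text{if } r\in[4,\infty),\end{cases}$$ and $\Psi(r)\sim\frac{6}{\pi^2}r^{-2}$ as $r\to\infty$. 2. $\frac{\pi^2}{3}\Psi$ is Hall's limiting gap distribution of the Farey sequence: for every $r\ge0$, among the gaps $y-x$ between consecutive reduced fractions in $[0,1]$ with denominators at most $N$, the proportion of those with $N^2(y-x)>r$ converges to $\frac{\pi^2}{3}\Psi(r)$ as $N\to\infty$. 3. $$\rho(s)=\frac3{\pi^2}\times\begin{cases}-e^{-s}+2+2e^{-s}\sqrt{\tfrac14-e^{s}}-4\log\Big(\tfrac12+\sqrt{\tfrac14-e^{s}}\Big)&\text{if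 } s\in(-\infty,-2\log2],\\ -e^{-s}+2-2s&\text{if } s\in[-2\log 2,0],\\ e^{-s}&\text{if } s\in[0,\infty),\end{cases}$$ and $\rho(s)\sim\frac6{\pi^2}e^{-|s|}$ as $s\to-\infty$. -/

import Mathlib

open MeasureTheory Filter Topology Asymptotics

namespace ModularHorocycle

/-- The group `SL(2, ℝ)`. -/
abbrev G : Type := Matrix.SpecialLinearGroup (Fin 2) ℝ

/-- The modular group `SL(2, ℤ)` as a subgroup of `SL(2, ℝ)`. -/
def Γ : Subgroup G := (Matrix.SpecialLinearGroup.map (n := Fin 2) (Int.castRingHom ℝ)).range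

/-- The space `Γ \ SL(2, ℝ)` of cosets `Γ g`, i.e. the unit tangent bundle of the modular
surface. -/
abbrev X : Type := Quotient (QuotientGroup.rightRel Γ)

/-- The right action `Γ g ↦ Γ g k` of `SL(2, ℝ)` on `X`. -/
def translate (x : X) (k : G) : X :=
  Quotient.map (fun g : G => g * k)
    (fun a b h => by
      have h' : b * a⁻¹ ∈ Γ := QuotientGroup.rightRel_apply.mp h
      refine QuotientGroup.rightRel_apply.mpr ?_
      simpa [mul_assoc] using h') x

/-- The matrix `diag(e^{t/2}, e^{-t/2})`. -/
noncomputable def aMat (t : ℝ) : G :=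
  ⟨!![Real.exp (t / 2), 0; 0, Real.exp (-t / 2)], by
    rw [Matrix.det_fin_two_of, mul_zero, sub_zero, ← Real.exp_add,
      show t / 2 + -t / 2 = 0 by ring, Real.exp_zero]⟩

/-- The lower triangular unipotent matrix `(1, 0; -s, 1)`. -/
def hPlusMat (s : ℝ) : G := ⟨!![1, 0; -s, 1], by simp [Matrix.det_fin_two_of]⟩

/-- The upper triangular unipotent matrix `(1, s; 0, 1)`. -/
def hMinusMat (s : ℝ) : G := ⟨!![1, s; 0, 1], by simp [Matrix.det_fin_two_of]⟩

/-- The geodesic flow `φ_t`. -/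
noncomputable def geodesicFlow (t : ℝ) (x : X) : X := translate x (aMat t)

/-- The unstable horocycle flow `h⁺_s`. -/
def horoPlus (s : ℝ) (x : X) : X := translate x (hPlusMat s)

/-- The stable horocycle flow `h⁻_s`. -/
def horoMinus (s : ℝ) (x : X) : X := translate x (hMinusMat s)

/-- The base point `Γ 1` on the closed stable horocycle of length one. -/
def basePoint : X := Quotient.mk _ (1 : G)

/-- The closed stable horocycle of length one around the cusp. -/
def cuspHorocycle : Set X := Set.range (fun s : ℝ => horoMinus s basePoint)

/-- The section `H(R)`, the union of the `φ_t (cuspHorocycle)` with `t ≥ R`. -/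
def crossSection (R : ℝ) : Set X := ⋃ t ∈ Set.Ici R, geodesicFlow t '' cuspHorocycle

/-- The parameter domain `[0,1) × [0,∞)` of the section. -/
def Sigma0 : Set (ℝ × ℝ) := Set.Ico 0 1 ×ˢ Set.Ici 0

/-- The parametrisation `ι_0 (s,t) = φ_t (h⁻_s (basePoint))` of the section `H(0)`. -/
noncomputable def iota0 (w : ℝ × ℝ) : X := geodesicFlow w.2 (horoMinus w.1 basePoint)

/-- The measure `dν(s,t) = e^{-t} dt ds` on `[0,1) × [0,∞)`. -/
noncomputable def nu : Measure (ℝ × ℝ) :=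
  (volume.restrict Sigma0).withDensity (fun w => ENNReal.ofReal (Real.exp (-w.2)))

/-- The first return time `η_1(w)` to `H(0)` of the unstable horocycle flow started at `ι_0(w)`. -/
noncomputable def returnTime (w : ℝ × ℝ) : ℝ :=
  sInf {r : ℝ | 0 < r ∧ horoPlus r (iota0 w) ∈ crossSection 0}

/-- The first backward return time `η_{-1}(w)`. -/
noncomputable def backwardReturnTime (w : ℝ × ℝ) : ℝ :=
  sInf {r : ℝ | 0 < r ∧ horoPlus (-r) (iota0 w) ∈ crossSection 0}

/-- The mean return time, the integral of `η_1` against `ν`. -/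
noncomputable def meanReturnTime : ℝ := ∫ w, returnTime w ∂nu

open Classical in
/-- The joint limit density `Ψ(r,w)` of the first hitting time and impact parameter. -/
noncomputable def jointDensity (r : ℝ) (w : ℝ × ℝ) : ℝ :=
  (1 / meanReturnTime) * (if r < backwardReturnTime w then 1 else 0)

/-- The hitting time density `Ψ(r)`. -/
noncomputable def hittingDensity (r : ℝ) : ℝ := ∫ w, jointDensity r w ∂nu

/-- The extreme value density `ρ(s) = e^{-s} Ψ(e^{-s})`. -/
noncomputable def extremeDensity (s : ℝ) : ℝ :=
  Real.exp (-s) * hittingDensity (Real.exp (-s))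

/-- The Farey fractions of level `N`: reduced fractions in `[0,1]` with denominator at most `N`. -/
def farey (N : ℕ) : Set ℚ := {x | 0 ≤ x ∧ x ≤ 1 ∧ x.den ≤ N}

/-- The pairs `(x, y)` of consecutive Farey fractions of level `N`. -/
def fareyPairs (N : ℕ) : Set (ℚ × ℚ) :=
  {p | p.1 ∈ farey N ∧ p.2 ∈ farey N ∧ p.1 < p.2 ∧ ∀ z ∈ farey N, ¬ (p.1 < z ∧ z < p.2)}

/-- The proportion of the gaps `y - x` between consecutive Farey fractions of level `N`
for which `N² (y - x) > r`. -/
noncomputable def fareyGapTail (N : ℕ) (r : ℝ) : ℝ :=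
  ({p ∈ fareyPairs N | r < (N : ℝ) ^ 2 * ((p.2 : ℝ) - (p.1 : ℝ))}.ncard : ℝ)
    / ((fareyPairs N).ncard : ℝ)

end ModularHorocycle

namespace ModularHorocycle

/-! A coset `Γ g` is the unimodular lattice `ℤ² g` of row vectors, and it lies on the section
exactly when this lattice has a primitive vector `(0, v)` with `0 < v ≤ 1` (`mem_crossSection_iff`).
For the point with parameters `(s, t)` put `y = e^{-t/2}`; the lattice has basis `(0, y)`, `(1/y, s
y)`. The flow `h⁺_r` is a shear preserving second coordinates, so a vector becomes vertical at the
time given by its slope. The first to do so is `(1/y, v)`, where `v = nextHeight s y` is the largest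
element of `s y + ℤ y` not exceeding `1`; the return time is `1/(y v)`. The backward flow is the
same picture with `s` replaced by `-s`.

For fixed `y`, uniform `s` makes `v` uniform on `(1 - y, 1]`, and `e^{-t} dt = 2 y dy`. Hence `ν`
becomes `2 dy dv` on the Farey triangle `0 < y ≤ 1`, `1 - y < v ≤ 1`. The mean return time is then
`∑ 2/n² = π²/3`, and `Ψ(r)` is `3/π²` times `triangleArea r`, twice the area of the part of the
triangle where `r y v < 1` (`hittingDensity_eq`). Elementary integrals give the closed forms: the
hyperbola `r y v = 1` enters the triangle at `r = 1` and meets the side `y + v = 1` from `r = 4` on.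

On the Farey side, consecutive fractions of level `N` correspond to coprime denominators `a, b ≤ N <
a + b`, with gap `1/(a b)`. Scaled by `N`, these are the primitive lattice points of the same
triangle, with the same condition `r a b < N²`. Lattice point counting and Möbius inversion show
that their number is asymptotic to `N²` times the area times `∑ μ(d)/d²`. This constant cancels in
the proportion, leaving `triangleArea r` (`tendsto_fareyGapTail`). -/

/-! ### Return times from the lattice picture -/

/-- The return times of the lattice with basis `(0, y)`, `(1 / y, s y)` to the section, under the
shear of slope `r`. -/
def latticeReturnTimes (s y : ℝ) : Set ℝ :=
  {r | 0 < r ∧ ∃ c d : ℤ, IsCoprime c d ∧ (c : ℝ) / y = r * ((c * s + d) * y) ∧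
    0 < (c * s + d) * y ∧ (c * s + d) * y ≤ 1}

/-- The representative of `s y` modulo `y` in `(1 - y, 1]`. -/
noncomputable def nextHeight (s y : ℝ) : ℝ := 1 - y * Int.fract (1 / y - s)

lemma nextHeight_le_one (s : ℝ) {y : ℝ} (hy : 0 < y) : nextHeight s y ≤ 1 := by
  have := mul_nonneg hy.le (Int.fract_nonneg (1 / y - s))
  unfold nextHeight; linarith

lemma one_sub_lt_nextHeight (s : ℝ) {y : ℝ} (hy : 0 < y) : 1 - y < nextHeight s y := by
  have := mul_lt_mul_of_pos_left (Int.fract_lt_one (1 / y - s)) hy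
  unfold nextHeight; linarith

lemma nextHeight_eq (s : ℝ) {y : ℝ} (hy : 0 < y) :
    nextHeight s y = (s + (⌊1 / y - s⌋ : ℤ)) * y := by
  have h : y * (1 / y) = 1 := by field_simp
  unfold nextHeight Int.fract
  linear_combination -h

/-- The infimum is attained at `c = 1`, with the highest admissible vector. A vector with larger `c`
has height at most `c v`, so its inverse slope gains nothing. -/
lemma sInf_latticeReturnTimes (s : ℝ) {y : ℝ} (hy : 0 < y) (hy1 : y ≤ 1) :
    sInf (latticeReturnTimes s y) = 1 / (y * nextHeight s y) := by
  have hv0 : 0 < nextHeight s y := by linarith [one_sub_lt_nextHeight s hy]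
  have hv1 := nextHeight_le_one s hy
  have hv2 := one_sub_lt_nextHeight s hy
  have hv := nextHeight_eq s hy
  set v := nextHeight s y with hvdef
  set e : ℤ := ⌊1 / y - s⌋ with he
  refine IsLeast.csInf_eq ⟨⟨by positivity, 1, e, isCoprime_one_left, ?_, ?_, ?_⟩, ?_⟩
  · rw [Int.cast_one, one_mul, ← hv]; field_simp
  · rwa [Int.cast_one, one_mul, ← hv]
  · rwa [Int.cast_one, one_mul, ← hv]
  rintro r ⟨hr, c, d, -, h1, h2, h3⟩
  set u := (c * s + d) * y with hu
  have hc0 : (0 : ℝ) < c := by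
    have : 0 < (c : ℝ) / y := by rw [h1]; positivity
    exact (div_pos_iff_of_pos_right hy).1 this
  have hc1 : (1 : ℤ) ≤ c := by exact_mod_cast hc0
  have hc1' : (1 : ℝ) ≤ c := by exact_mod_cast hc1
  -- Heights over `c` differ from `c v` by multiples of `y`; a positive multiple would give `u ≥ v +
  -- y > 1`.
  have key : u ≤ c * v := by
    have hrel : u = c * v + ((d - c * e : ℤ) : ℝ) * y := by
      rw [hv, hu]; push_cast; ring
    rcases le_or_gt (d - c * e) 0 with hk | hk
    · have : ((d - c * e : ℤ) : ℝ) ≤ 0 := by exact_mod_cast hk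
      nlinarith
    · have : (1 : ℝ) ≤ ((d - c * e : ℤ) : ℝ) := by exact_mod_cast hk
      nlinarith
  have hr' : r = c / (y * u) := by
    field_simp at h1 ⊢; linarith
  rw [hr', div_le_div_iff₀ (by positivity) (by positivity)]
  nlinarith

lemma coe_hMinusMat_mul_aMat (s t : ℝ) :
    ((hMinusMat s * aMat t : G) : Matrix (Fin 2) (Fin 2) ℝ) =
      !![Real.exp (t / 2), s * Real.exp (-t / 2); 0, Real.exp (-t / 2)] := by
  have h1 : (hMinusMat s : Matrix (Fin 2) (Fin 2) ℝ) = !![1, s; 0, 1] := rfl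
  have h2 : (aMat t : Matrix (Fin 2) (Fin 2) ℝ) =
    !![Real.exp (t / 2), 0; 0, Real.exp (-t / 2)] := rfl
  rw [Matrix.SpecialLinearGroup.coe_mul, h1, h2]
  simp

/-- The bottom row of `γ g` is an arbitrary primitive vector of `ℤ² g`, while the bottom row of a
section representative is `(0, e^{-t/2})` with `t ≥ 0`. The top row imposes nothing more: its first
entry is fixed by the determinant and its second by the free parameter `s`. -/
lemma mem_crossSection_iff (g : G) :
    (Quotient.mk _ g : X) ∈ crossSection 0 ↔
      ∃ c d : ℤ, IsCoprime c d ∧ c * g 0 0 + d * g 1 0 = 0 ∧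
        0 < c * g 0 1 + d * g 1 1 ∧ c * g 0 1 + d * g 1 1 ≤ 1 := by
  have hmem : (Quotient.mk _ g : X) ∈ crossSection 0 ↔
      ∃ t : ℝ, 0 ≤ t ∧ ∃ s : ℝ, ∃ γ : Matrix.SpecialLinearGroup (Fin 2) ℤ,
        hMinusMat s * aMat t = Matrix.SpecialLinearGroup.map (Int.castRingHom ℝ) γ * g := by
    simp only [crossSection, cuspHorocycle, Set.mem_iUnion, Set.mem_Ici, Set.mem_image,
      Set.mem_range, exists_exists_eq_and, exists_prop]
    refine exists_congr fun t => and_congr_right fun _ => exists_congr fun s => ?_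
    have : geodesicFlow t (horoMinus s basePoint) =
        (Quotient.mk _ (1 * hMinusMat s * aMat t) : X) := rfl
    rw [this, eq_comm, Quotient.eq, one_mul]
    change QuotientGroup.rightRel Γ _ _ ↔ _
    rw [QuotientGroup.rightRel_apply, Γ, MonoidHom.mem_range]
    exact exists_congr fun γ => by rw [eq_mul_inv_iff_mul_eq, eq_comm]
  rw [hmem]
  have hdet : g 0 0 * g 1 1 - g 0 1 * g 1 0 = 1 := by
    rw [← Matrix.det_fin_two]; exact g.2
  constructor
  · rintro ⟨t, ht, s, γ, h⟩
    have hγ : γ 0 0 * γ 1 1 - γ 0 1 * γ 1 0 = 1 := by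
      rw [← Matrix.det_fin_two]; exact γ.2
    have hM := congrArg (fun m : G => (m : Matrix (Fin 2) (Fin 2) ℝ)) h
    simp only [coe_hMinusMat_mul_aMat] at hM
    have h10 := congrFun (congrFun hM 1) 0
    have h11 := congrFun (congrFun hM 1) 1
    simp [Matrix.mul_apply, Fin.sum_univ_two] at h10 h11
    refine ⟨γ 1 0, γ 1 1, ⟨-γ 0 1, γ 0 0, by linarith⟩, by linarith, ?_, ?_⟩
    · rw [← h11]; positivity
    · rw [← h11, Real.exp_le_one_iff]; linarith
  · rintro ⟨c, d, ⟨p, q, hpq⟩, h0, h1, h2⟩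
    set v := c * g 0 1 + d * g 1 1 with hv
    have hpqR : (p : ℝ) * c + q * d = 1 := by exact_mod_cast hpq
    have he1 : Real.exp (-(-2 * Real.log v) / 2) = v := by
      rw [show -(-2 * Real.log v) / 2 = Real.log v by ring, Real.exp_log h1]
    have he2 : Real.exp ((-2 * Real.log v) / 2) = v⁻¹ := by
      rw [show (-2 * Real.log v) / 2 = -Real.log v by ring, Real.exp_neg, Real.exp_log h1]
    -- Here `t` solves `e^{-t/2} = v`, and `s v` is the upper right entry of `γ g`.
    refine ⟨-2 * Real.log v, by nlinarith [Real.log_nonpos h1.le h2],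
      (q * g 0 1 - p * g 1 1) / v,
      ⟨!![q, -p; c, d], by rw [Matrix.det_fin_two_of]; linarith⟩, Subtype.ext ?_⟩
    change ((hMinusMat _ * aMat _ : G) : Matrix (Fin 2) (Fin 2) ℝ) = _
    have hγ : ∀ h, ((Matrix.SpecialLinearGroup.map (Int.castRingHom ℝ)
        (⟨!![q, -p; c, d], h⟩ : Matrix.SpecialLinearGroup (Fin 2) ℤ) : G) :
        Matrix (Fin 2) (Fin 2) ℝ) = !![(q : ℝ), -p; c, d] := fun h => by
      change (!![q, -p; c, d]).map (Int.castRingHom ℝ) = _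
      ext i j
      fin_cases i <;> fin_cases j <;> simp
    rw [coe_hMinusMat_mul_aMat, he1, he2, Matrix.SpecialLinearGroup.coe_mul, hγ]
    ext i j
    fin_cases i <;> fin_cases j <;> simp [Matrix.mul_apply, Fin.sum_univ_two]
    · refine inv_eq_of_mul_eq_one_right ?_
      rw [hv]
      linear_combination (q * g 0 1 - p * g 1 1) * h0 + (p * c + q * d) * hdet + hpqR
    · field_simp; ring
    · linarith
    · linarith

lemma horoPlus_iota0_mem_iff (r : ℝ) (w : ℝ × ℝ) :
    horoPlus r (iota0 w) ∈ crossSection 0 ↔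
      ∃ c d : ℤ, IsCoprime c d ∧
        (c : ℝ) / Real.exp (-w.2 / 2) = r * ((c * w.1 + d) * Real.exp (-w.2 / 2)) ∧
        0 < (c * w.1 + d) * Real.exp (-w.2 / 2) ∧ (c * w.1 + d) * Real.exp (-w.2 / 2) ≤ 1 := by
  have : horoPlus r (iota0 w) =
      (Quotient.mk _ (1 * hMinusMat w.1 * aMat w.2 * hPlusMat r) : X) := rfl
  rw [this, mem_crossSection_iff]
  have he : Real.exp (w.2 / 2) = (Real.exp (-w.2 / 2))⁻¹ := by
    rw [← Real.exp_neg]; ring_nf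
  have hP : (hPlusMat r : Matrix (Fin 2) (Fin 2) ℝ) = !![1, 0; -r, 1] := rfl
  rw [one_mul, Matrix.SpecialLinearGroup.coe_mul, coe_hMinusMat_mul_aMat, hP, he]
  simp only [Matrix.mul_apply, Fin.sum_univ_two, Matrix.of_apply, Matrix.cons_val',
    Matrix.cons_val_zero, Matrix.cons_val_one, Matrix.cons_val_fin_one]
  refine exists_congr fun c => exists_congr fun d => and_congr_right fun _ => and_congr ?_ ?_
  · rw [← sub_eq_zero (a := (c : ℝ) / _)]
    ring_nf
  · ring_nf

lemma returnTime_eq {w : ℝ × ℝ} (hw : 0 ≤ w.2) :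
    returnTime w = 1 / (Real.exp (-w.2 / 2) * nextHeight w.1 (Real.exp (-w.2 / 2))) := by
  rw [← sInf_latticeReturnTimes w.1 (Real.exp_pos _)
    (Real.exp_le_one_iff.2 (by linarith)), returnTime]
  simp_rw [horoPlus_iota0_mem_iff]
  rfl

lemma backwardReturnTime_eq {w : ℝ × ℝ} (hw : 0 ≤ w.2) :
    backwardReturnTime w =
      1 / (Real.exp (-w.2 / 2) * nextHeight (-w.1) (Real.exp (-w.2 / 2))) := by
  rw [← sInf_latticeReturnTimes (-w.1) (Real.exp_pos _)
    (Real.exp_le_one_iff.2 (by linarith)), backwardReturnTime]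
  congr 1
  ext r
  simp_rw [horoPlus_iota0_mem_iff]
  -- Reflection in the vertical axis: `c ↦ -c` together with `s ↦ -s` keeps the heights and reverses
  -- the slopes.
  refine and_congr_right fun _ => (Equiv.neg ℤ).exists_congr fun c => exists_congr fun d => ?_
  simp only [Equiv.neg_apply, Int.cast_neg, IsCoprime.neg_left_iff, neg_mul_neg,
    neg_div (Real.exp (-w.2 / 2))]
  refine and_congr_right fun _ => and_congr_left fun _ => ?_
  rw [neg_div, neg_eq_iff_eq_neg, neg_mul]

/-! ### The image of `ν` on the Farey triangle -/

lemma setLIntegral_Ioc_of_periodic {f : ℝ → ENNReal} (hf : Function.Periodic f 1) (a b : ℝ) :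
    ∫⁻ x in Set.Ioc a (a + 1), f x = ∫⁻ x in Set.Ioc b (b + 1), f x := by
  have : VAddInvariantMeasure (AddSubgroup.zmultiples (1 : ℝ)) ℝ volume :=
    ⟨fun c s _ => measure_preimage_add _ _ _⟩
  exact IsAddFundamentalDomain.setLIntegral_eq (G := AddSubgroup.zmultiples (1 : ℝ))
    (isAddFundamentalDomain_Ioc one_pos a) (isAddFundamentalDomain_Ioc one_pos b) _
    hf.map_vadd_zmultiples

lemma setLIntegral_comp_one_sub_mul_fract {y : ℝ} (hy : 0 < y) (k : ℝ → ENNReal) (a : ℝ) :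
    ENNReal.ofReal y * ∫⁻ x in Set.Ioc a (a + 1), k (1 - y * Int.fract x) =
      ∫⁻ v in Set.Ioc (1 - y) 1, k v := by
  have hper : Function.Periodic (fun x : ℝ => k (1 - y * Int.fract x)) 1 := fun x => by
    simp only [Int.fract_add_one]
  have himg : (fun x : ℝ => 1 - y * x) '' Set.Ico 0 1 = Set.Ioc (1 - y) 1 := by
    ext v
    simp only [Set.mem_image, Set.mem_Ico, Set.mem_Ioc]
    constructor
    · rintro ⟨x, ⟨h0, h1⟩, rfl⟩
      constructor <;> nlinarith
    · rintro ⟨h0, h1⟩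
      refine ⟨(1 - v) / y, ⟨div_nonneg (by linarith) hy.le, ?_⟩, by field_simp; ring⟩
      rw [div_lt_one hy]; linarith
  have hinj : Set.InjOn (fun x : ℝ => 1 - y * x) (Set.Ico 0 1) := fun x _ x' _ h =>
    mul_left_cancel₀ hy.ne' (sub_right_injective h)
  have hder : ∀ x ∈ Set.Ico (0 : ℝ) 1,
      HasDerivWithinAt (fun x : ℝ => 1 - y * x) (-y) (Set.Ico 0 1) x := fun x _ => by
    simpa using (((hasDerivAt_id x).const_mul y).const_sub 1).hasDerivWithinAt
  rw [setLIntegral_Ioc_of_periodic hper a 0, zero_add, ← himg,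
    lintegral_image_eq_lintegral_abs_deriv_mul measurableSet_Ico hder hinj,
    abs_neg, abs_of_pos hy, lintegral_const_mul' _ _ ENNReal.ofReal_ne_top]
  congr 1
  rw [setLIntegral_congr Ico_ae_eq_Ioc.symm]
  exact setLIntegral_congr_fun measurableSet_Ico fun x hx => by
    simp only [Int.fract_eq_self.2 hx]

/-- The substitution `x = 1/y - s` turns the height into `1 - y * Int.fract x` over a full period,
which is uniform on `(1 - y, 1]`. -/
lemma setLIntegral_nextHeight {y : ℝ} (hy : 0 < y) (k : ℝ → ENNReal) :
    ENNReal.ofReal y * ∫⁻ s in Set.Ico 0 1, k (nextHeight s y) =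
      ∫⁻ v in Set.Ioc (1 - y) 1, k v := by
  have h := (Measure.measurePreserving_sub_left volume (1 / y)).setLIntegral_comp_preimage_emb
    (MeasurableEquiv.subLeft (1 / y)).measurableEmbedding (fun x => k (1 - y * Int.fract x))
    (Set.Ioc (1 / y - 1) (1 / y - 1 + 1))
  rw [← setLIntegral_comp_one_sub_mul_fract hy k (1 / y - 1), ← h]
  simp [nextHeight]

lemma setLIntegral_nextHeight_neg {y : ℝ} (hy : 0 < y) (k : ℝ → ENNReal) :
    ENNReal.ofReal y * ∫⁻ s in Set.Ico 0 1, k (nextHeight (-s) y) =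
      ∫⁻ v in Set.Ioc (1 - y) 1, k v := by
  have h := (measurePreserving_add_left volume (1 / y)).setLIntegral_comp_preimage_emb
    (MeasurableEquiv.addLeft (1 / y)).measurableEmbedding (fun x => k (1 - y * Int.fract x))
    (Set.Ioc (1 / y) (1 / y + 1))
  rw [← setLIntegral_comp_one_sub_mul_fract hy k (1 / y), ← h, setLIntegral_congr Ico_ae_eq_Ioc]
  simp [nextHeight]

lemma measurable_nextHeight : Measurable fun p : ℝ × ℝ => nextHeight p.1 p.2 := by
  unfold nextHeight
  fun_prop

lemma setLIntegral_exp_neg_half (Φ : ℝ → ENNReal) :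
    ∫⁻ t in Set.Ici 0, ENNReal.ofReal (Real.exp (-t / 2) / 2) * Φ (Real.exp (-t / 2)) =
      ∫⁻ y in Set.Ioc 0 1, Φ y := by
  have himg : (fun t : ℝ => Real.exp (-t / 2)) '' Set.Ici 0 = Set.Ioc 0 1 := by
    ext y
    simp only [Set.mem_image, Set.mem_Ici, Set.mem_Ioc]
    constructor
    · rintro ⟨t, ht, rfl⟩
      exact ⟨Real.exp_pos _, Real.exp_le_one_iff.2 (by linarith)⟩
    · rintro ⟨h0, h1⟩
      refine ⟨-2 * Real.log y, by linarith [Real.log_nonpos h0.le h1], ?_⟩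
      rw [show -(-2 * Real.log y) / 2 = Real.log y by ring, Real.exp_log h0]
  have hinj : Set.InjOn (fun t : ℝ => Real.exp (-t / 2)) (Set.Ici 0) := fun x _ x' _ h => by
    have := Real.exp_injective h
    linarith
  have hder : ∀ t ∈ Set.Ici (0 : ℝ), HasDerivWithinAt (fun t : ℝ => Real.exp (-t / 2))
      (-(Real.exp (-t / 2) / 2)) (Set.Ici 0) t := fun t _ => by
    convert! (((hasDerivAt_id t).neg.div_const 2).exp).hasDerivWithinAt using 1
    simp only [Pi.neg_apply, id]
    ring
  rw [← himg, lintegral_image_eq_lintegral_abs_deriv_mul measurableSet_Ici hder hinj]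
  refine lintegral_congr fun t => ?_
  rw [abs_neg, abs_of_pos (by positivity)]

/-- Integration over the section in the coordinates given by two consecutive heights. -/
lemma lintegral_nu_of_equidistributed {F : ℝ × ℝ → ENNReal} (hF : Measurable F)
    {h : ℝ → ℝ → ENNReal}
    (hFh : ∀ t : ℝ, 0 ≤ t → ENNReal.ofReal (Real.exp (-t / 2)) * ∫⁻ s in Set.Ico 0 1, F (s, t) =
      ∫⁻ v in Set.Ioc (1 - Real.exp (-t / 2)) 1, h (Real.exp (-t / 2)) v) :
    ∫⁻ w, F w ∂nu = ∫⁻ y in Set.Ioc 0 1, 2 * ∫⁻ v in Set.Ioc (1 - y) 1, h y v := by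
  have hm : Measurable fun w : ℝ × ℝ => ENNReal.ofReal (Real.exp (-w.2)) := by fun_prop
  rw [nu, lintegral_withDensity_eq_lintegral_mul _ hm hF, Sigma0, Measure.volume_eq_prod,
    ← Measure.prod_restrict, lintegral_prod_symm _ (hm.mul hF).aemeasurable,
    ← setLIntegral_exp_neg_half]
  refine setLIntegral_congr_fun measurableSet_Ici fun t ht => ?_
  simp only [Pi.mul_apply]
  have hexp : Real.exp (-t) = Real.exp (-t / 2) * Real.exp (-t / 2) := by
    rw [← Real.exp_add, add_halves]
  rw [lintegral_const_mul' _ _ ENNReal.ofReal_ne_top, ← hFh t ht, ← mul_assoc, ← mul_assoc,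
    hexp, ENNReal.ofReal_mul (Real.exp_pos _).le]
  congr 2
  rw [show (2 : ENNReal) = ENNReal.ofReal 2 by simp, ← ENNReal.ofReal_mul (by positivity)]
  congr 1
  ring_nf

lemma lintegral_nu_nextHeight {h : ℝ → ℝ → ENNReal} (hh : Measurable (Function.uncurry h)) :
    ∫⁻ w, h (Real.exp (-w.2 / 2)) (nextHeight w.1 (Real.exp (-w.2 / 2))) ∂nu =
      ∫⁻ y in Set.Ioc 0 1, 2 * ∫⁻ v in Set.Ioc (1 - y) 1, h y v := by
  refine lintegral_nu_of_equidistributed ?_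
    fun t _ => setLIntegral_nextHeight (Real.exp_pos (-t / 2)) (h (Real.exp (-t / 2)))
  exact hh.comp (Measurable.prodMk (by fun_prop) (measurable_nextHeight.comp
    (show Measurable fun w : ℝ × ℝ => (w.1, Real.exp (-w.2 / 2)) by fun_prop)))

lemma lintegral_nu_nextHeight_neg {h : ℝ → ℝ → ENNReal} (hh : Measurable (Function.uncurry h)) :
    ∫⁻ w, h (Real.exp (-w.2 / 2)) (nextHeight (-w.1) (Real.exp (-w.2 / 2))) ∂nu =
      ∫⁻ y in Set.Ioc 0 1, 2 * ∫⁻ v in Set.Ioc (1 - y) 1, h y v := by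
  refine lintegral_nu_of_equidistributed ?_
    fun t _ => setLIntegral_nextHeight_neg (Real.exp_pos (-t / 2)) (h (Real.exp (-t / 2)))
  exact hh.comp (Measurable.prodMk (by fun_prop) (measurable_nextHeight.comp
    (show Measurable fun w : ℝ × ℝ => (-w.1, Real.exp (-w.2 / 2)) by fun_prop)))

lemma ae_nu_mem_Sigma0 : ∀ᵐ w ∂nu, w ∈ Sigma0 :=
  (withDensity_absolutelyContinuous _ _).ae_le
    (ae_restrict_mem (measurableSet_Ico.prod measurableSet_Ici))

/-! ### The mean return time -/

/-- The inner integral is `-2 log(1 - y)/y`, expanded in a power series so that it can be integrated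
term by term. It diverges at `y = 1`, a null set that is left out. -/
lemma lintegral_two_mul_inv {y : ℝ} (hy : y ∈ Set.Ioo (0 : ℝ) 1) :
    2 * ∫⁻ v in Set.Ioc (1 - y) 1, ENNReal.ofReal (1 / (y * v)) =
      ∑' n : ℕ, ENNReal.ofReal (2 / (n + 1) * y ^ n) := by
  have h1 : 0 < 1 - y := by linarith [hy.2]
  have hi : IntervalIntegrable (fun v : ℝ => 1 / (y * v)) volume (1 - y) 1 := by
    refine ContinuousOn.intervalIntegrable fun v hv => ?_
    rw [Set.uIcc_of_le (by linarith [hy.1])] at hv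
    have : y * v ≠ 0 := (mul_pos hy.1 (h1.trans_le hv.1)).ne'
    exact ContinuousAt.continuousWithinAt (by fun_prop (disch := assumption))
  have hval : ∫ v in Set.Ioc (1 - y) 1, 1 / (y * v) = -Real.log (1 - y) / y := by
    rw [← intervalIntegral.integral_of_le (by linarith [hy.1])]
    simp_rw [one_div, mul_inv]
    rw [intervalIntegral.integral_const_mul, integral_inv_of_pos h1 one_pos, Real.log_div
      one_ne_zero h1.ne', Real.log_one]
    ring
  have hsum := (Real.hasSum_pow_div_log_of_abs_lt_one
    (show |y| < 1 by rw [abs_of_pos hy.1]; exact hy.2)).mul_left (2 / y)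
  rw [← ofReal_integral_eq_lintegral_ofReal
    ((intervalIntegrable_iff_integrableOn_Ioc_of_le (by linarith [hy.1])).1 hi)
    ((ae_restrict_mem measurableSet_Ioc).mono fun v hv => by
      have := h1.trans hv.1
      have := hy.1
      simp only [Pi.zero_apply]; positivity), hval,
    show (2 : ENNReal) = ENNReal.ofReal 2 by simp, ← ENNReal.ofReal_mul (by norm_num),
    show 2 * (-Real.log (1 - y) / y) = 2 / y * -Real.log (1 - y) by ring, ← hsum.tsum_eq,
    ENNReal.ofReal_tsum_of_nonneg (fun n => by have := hy.1; positivity) hsum.summable]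
  refine tsum_congr fun n => ?_
  congr 1
  have := hy.1
  field_simp
  ring

lemma lintegral_two_div_mul_pow (n : ℕ) :
    ∫⁻ y in Set.Ioc (0 : ℝ) 1, ENNReal.ofReal (2 / (n + 1) * y ^ n) =
      ENNReal.ofReal (2 * (1 / ((n + 1 : ℕ) : ℝ) ^ 2)) := by
  have hi : IntervalIntegrable (fun y : ℝ => 2 / ((n : ℝ) + 1) * y ^ n) volume 0 1 :=
    Continuous.intervalIntegrable (by fun_prop) _ _
  rw [← ofReal_integral_eq_lintegral_ofReal
    ((intervalIntegrable_iff_integrableOn_Ioc_of_le zero_le_one).1 hi)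
    ((ae_restrict_mem measurableSet_Ioc).mono fun v hv => by
      have := hv.1
      simp only [Pi.zero_apply]; positivity),
    ← intervalIntegral.integral_of_le zero_le_one, intervalIntegral.integral_const_mul,
    integral_pow]
  congr 1
  push_cast
  field_simp
  simp

lemma meanReturnTime_eq : meanReturnTime = Real.pi ^ 2 / 3 := by
  have hm : Measurable fun w : ℝ × ℝ =>
      1 / (Real.exp (-w.2 / 2) * nextHeight w.1 (Real.exp (-w.2 / 2))) :=
    (Measurable.mul (by fun_prop) (measurable_nextHeight.comp
      (show Measurable fun w : ℝ × ℝ => (w.1, Real.exp (-w.2 / 2)) by fun_prop))).const_div 1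
  -- The term `n = 0` of the zeta sum is `1 / 0 = 0` and is dropped to match the series indexed by
  -- `n + 1`.
  have hz := ((hasSum_nat_add_iff' 1).2 hasSum_zeta_two).mul_left 2
  simp only [Finset.range_one, Finset.sum_singleton, Nat.cast_zero, ne_eq, OfNat.ofNat_ne_zero,
    not_false_eq_true, zero_pow, div_zero, sub_zero] at hz
  have hae : returnTime =ᵐ[nu] fun w : ℝ × ℝ =>
      1 / (Real.exp (-w.2 / 2) * nextHeight w.1 (Real.exp (-w.2 / 2))) :=
    ae_nu_mem_Sigma0.mono fun w hw => returnTime_eq hw.2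
  rw [meanReturnTime, integral_congr_ae hae, integral_eq_lintegral_of_nonneg_ae
    (ae_nu_mem_Sigma0.mono fun w hw => ?_) hm.aestronglyMeasurable,
    lintegral_nu_nextHeight (h := fun y v => ENNReal.ofReal (1 / (y * v))) (by
      unfold Function.uncurry; fun_prop),
    setLIntegral_congr Ioo_ae_eq_Ioc.symm,
    setLIntegral_congr_fun measurableSet_Ioo fun y hy => lintegral_two_mul_inv hy,
    setLIntegral_congr Ioo_ae_eq_Ioc, lintegral_tsum fun n => by fun_prop]
  · simp_rw [lintegral_two_div_mul_pow]
    rw [← ENNReal.ofReal_tsum_of_nonneg (fun n => by positivity) hz.summable, hz.tsum_eq,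
      ENNReal.toReal_ofReal (by positivity)]
    ring
  · have hy := Real.exp_pos (-w.2 / 2)
    have hy1 : Real.exp (-w.2 / 2) ≤ 1 := Real.exp_le_one_iff.2 (by linarith [show 0 ≤ w.2 from hw.2])
    have := one_sub_lt_nextHeight w.1 hy
    have : 0 < nextHeight w.1 (Real.exp (-w.2 / 2)) := by linarith
    simp only [Pi.zero_apply]; positivity

/-! ### The hitting density as an area -/

/-- The upper boundary of the region `{(y, v) : v ≤ 1, r y v < 1}`. -/
noncomputable def upperHeight (r y : ℝ) : ℝ := 1 / max 1 (r * y)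

/-- The upper boundary of the region `{(y, v) : y + v ≤ 1, r y v < 1}`. -/
noncomputable def lowerHeight (r y : ℝ) : ℝ := min (1 - y) (upperHeight r y)

lemma continuous_upperHeight (r : ℝ) : Continuous (upperHeight r) :=
  continuous_const.div₀ (by fun_prop) fun _ => (zero_lt_one.trans_le (le_max_left _ _)).ne'

lemma continuous_lowerHeight (r : ℝ) : Continuous (lowerHeight r) :=
  Continuous.min (by fun_prop) (continuous_upperHeight r)

lemma upperHeight_pos (r y : ℝ) : 0 < upperHeight r y :=
  one_div_pos.2 (zero_lt_one.trans_le (le_max_left _ _))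

lemma upperHeight_le_one (r y : ℝ) : upperHeight r y ≤ 1 :=
  div_le_one_of_le₀ (le_max_left _ _) (zero_le_one.trans (le_max_left _ _))

lemma lt_upperHeight_iff {r y v : ℝ} (hv : 0 < v) :
    v < upperHeight r y ↔ v < 1 ∧ r * y * v < 1 := by
  rw [upperHeight, lt_div_iff₀ (zero_lt_one.trans_le (le_max_left _ _)), mul_max_of_nonneg _ _ hv.le,
    max_lt_iff, mul_one, mul_comm v]

lemma le_upperHeight_iff {r y v : ℝ} (hv : 0 < v) :
    v ≤ upperHeight r y ↔ v ≤ 1 ∧ r * y * v ≤ 1 := by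
  rw [upperHeight, le_div_iff₀ (zero_lt_one.trans_le (le_max_left _ _)), mul_max_of_nonneg _ _ hv.le,
    max_le_iff, mul_one, mul_comm v]

/-- Twice the area of the part of the Farey triangle where `r y v < 1`. -/
noncomputable def triangleArea (r : ℝ) : ℝ :=
  2 * ∫ y in (0 : ℝ)..1, (upperHeight r y - lowerHeight r y)

open Classical in
lemma lintegral_indicator_mul_lt_one {r y : ℝ} (hy : y ∈ Set.Ioc (0 : ℝ) 1) :
    ∫⁻ v in Set.Ioc (1 - y) 1, (if r * y * v < 1 then 1 else 0 : ENNReal) =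
      ENNReal.ofReal (upperHeight r y - lowerHeight r y) := by
  have hmeas : MeasurableSet {v : ℝ | r * y * v < 1} := measurableSet_lt (by fun_prop) (by fun_prop)
  have h1 : ∫⁻ v in Set.Ioc (1 - y) 1, (if r * y * v < 1 then 1 else 0 : ENNReal) =
      volume ({v : ℝ | r * y * v < 1} ∩ Set.Ioc (1 - y) 1) := by
    rw [← Measure.restrict_apply hmeas, ← lintegral_indicator_one hmeas]
    rfl
  -- When the hyperbola lies below the line `y + v = 1` the slice is empty, and `ENNReal.ofReal`
  -- truncates the negative length to `0`.
  have h2 : ENNReal.ofReal (upperHeight r y - lowerHeight r y) =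
      ENNReal.ofReal (upperHeight r y - (1 - y)) := by
    rw [lowerHeight]
    rcases le_total (1 - y) (upperHeight r y) with h | h
    · rw [min_eq_left h]
    · rw [min_eq_right h, sub_self, ENNReal.ofReal_zero, ENNReal.ofReal_of_nonpos (by linarith)]
  have h0 : 0 ≤ 1 - y := by linarith [hy.2]
  rw [h1, h2]
  -- The slice lies between the open and the half-open interval with these endpoints, which have
  -- equal length.
  refine le_antisymm ?_ ?_
  · rw [← Real.volume_Ioc]
    refine measure_mono fun v hv => ⟨hv.2.1, ?_⟩
    exact (le_upperHeight_iff (h0.trans_lt hv.2.1)).2 ⟨hv.2.2, le_of_lt hv.1⟩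
  · rw [← Real.volume_Ioo]
    refine measure_mono fun v hv => ?_
    have := (lt_upperHeight_iff (h0.trans_lt hv.1)).1 hv.2
    exact ⟨this.2, hv.1, this.1.le⟩

lemma hittingDensity_eq (r : ℝ) : hittingDensity r = 3 / Real.pi ^ 2 * triangleArea r := by
  classical
  have hmh : Measurable (Function.uncurry fun y v : ℝ =>
      (if r * y * v < 1 then 1 else 0 : ENNReal)) :=
    Measurable.ite (measurableSet_lt (by fun_prop) (by fun_prop)) measurable_const measurable_const
  have hmh' : Measurable (Function.uncurry fun y v : ℝ =>
      (if r * y * v < 1 then 1 else 0 : ℝ)) :=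
    Measurable.ite (measurableSet_lt (by fun_prop) (by fun_prop)) measurable_const measurable_const
  have hm : Measurable fun w : ℝ × ℝ =>
      (if r * Real.exp (-w.2 / 2) * nextHeight (-w.1) (Real.exp (-w.2 / 2)) < 1
        then 1 else 0 : ℝ) :=
    hmh'.comp (f := fun w : ℝ × ℝ => (Real.exp (-w.2 / 2),
      nextHeight (-w.1) (Real.exp (-w.2 / 2)))) (Measurable.prodMk (by fun_prop)
      (measurable_nextHeight.comp
        (show Measurable fun w : ℝ × ℝ => (-w.1, Real.exp (-w.2 / 2)) by fun_prop)))
  have hae : jointDensity r =ᵐ[nu] fun w : ℝ × ℝ => (1 / meanReturnTime) *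
      (if r * Real.exp (-w.2 / 2) * nextHeight (-w.1) (Real.exp (-w.2 / 2)) < 1
        then 1 else 0 : ℝ) := by
    refine ae_nu_mem_Sigma0.mono fun w hw => ?_
    have hy := Real.exp_pos (-w.2 / 2)
    have hy1 : Real.exp (-w.2 / 2) ≤ 1 := Real.exp_le_one_iff.2 (by linarith [show 0 ≤ w.2 from hw.2])
    have := one_sub_lt_nextHeight (-w.1) hy
    have : 0 < nextHeight (-w.1) (Real.exp (-w.2 / 2)) := by linarith
    simp only [jointDensity, backwardReturnTime_eq (show 0 ≤ w.2 from hw.2),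
      lt_div_iff₀ (show 0 < Real.exp (-w.2 / 2) * nextHeight (-w.1) (Real.exp (-w.2 / 2)) by
        positivity), ← mul_assoc]
  have hint : IntervalIntegrable (fun y => upperHeight r y - lowerHeight r y) volume 0 1 :=
    ((continuous_upperHeight r).sub (continuous_lowerHeight r)).intervalIntegrable _ _
  have hnn : ∀ y, 0 ≤ upperHeight r y - lowerHeight r y := fun y => sub_nonneg.2 (min_le_right _ _)
  rw [hittingDensity, integral_congr_ae hae, integral_const_mul, meanReturnTime_eq, triangleArea,
    one_div_div, integral_eq_lintegral_of_nonneg_ae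
      (ae_of_all _ fun w => by simp only [Pi.zero_apply]; positivity) hm.aestronglyMeasurable]
  congr 1
  have hE : ∀ w : ℝ × ℝ, ENNReal.ofReal
      (if r * Real.exp (-w.2 / 2) * nextHeight (-w.1) (Real.exp (-w.2 / 2)) < 1
        then 1 else 0 : ℝ) =
      if r * Real.exp (-w.2 / 2) * nextHeight (-w.1) (Real.exp (-w.2 / 2)) < 1
        then 1 else 0 := fun w => by split_ifs <;> simp
  simp_rw [hE]
  rw [lintegral_nu_nextHeight_neg hmh,
    setLIntegral_congr_fun measurableSet_Ioc fun y hy => by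
      rw [lintegral_indicator_mul_lt_one hy],
    lintegral_const_mul' _ _ (by simp), ← ofReal_integral_eq_lintegral_ofReal
    ((intervalIntegrable_iff_integrableOn_Ioc_of_le zero_le_one).1 hint)
    (ae_of_all _ hnn),
    ← intervalIntegral.integral_of_le zero_le_one, ENNReal.toReal_mul, ENNReal.toReal_ofReal
    (intervalIntegral.integral_nonneg zero_le_one fun y _ => hnn y), ENNReal.toReal_ofNat]

/-! ### Closed forms of the area -/

lemma upperHeight_of_le {r y : ℝ} (h : r * y ≤ 1) : upperHeight r y = 1 := by
  rw [upperHeight, max_eq_left h, div_one]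

lemma upperHeight_of_ge {r y : ℝ} (h : 1 ≤ r * y) : upperHeight r y = r⁻¹ * y⁻¹ := by
  rw [upperHeight, max_eq_right h, one_div, mul_inv]

lemma lowerHeight_of_le {r y : ℝ} (h0 : 0 ≤ y) (h : r * y * (1 - y) ≤ 1) :
    lowerHeight r y = 1 - y := by
  rcases le_or_gt (1 - y) 0 with h1 | h1
  · exact min_eq_left (h1.trans (upperHeight_pos r y).le)
  · exact min_eq_left ((le_upperHeight_iff h1).2 ⟨by linarith, h⟩)

lemma lowerHeight_of_ge {r y : ℝ} (hr : 0 ≤ r) (h0 : 0 ≤ y)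
    (h : 1 ≤ r * y * (1 - y)) : lowerHeight r y = r⁻¹ * y⁻¹ := by
  have h2 : 1 ≤ r * y := by nlinarith [mul_nonneg hr h0]
  have h3 : 0 < r * y := by linarith
  rw [lowerHeight, upperHeight_of_ge h2, min_eq_right]
  rw [← mul_inv, inv_eq_one_div, div_le_iff₀ h3]
  linarith

lemma triangleArea_eq (r : ℝ) :
    triangleArea r = 2 * ((∫ y in (0 : ℝ)..1, upperHeight r y) -
      ∫ y in (0 : ℝ)..1, lowerHeight r y) := by
  rw [triangleArea, intervalIntegral.integral_sub
    ((continuous_upperHeight r).intervalIntegrable _ _)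
    ((continuous_lowerHeight r).intervalIntegrable _ _)]

lemma integral_upperHeight_of_le_one {r : ℝ} (hr1 : r ≤ 1) :
    ∫ y in (0 : ℝ)..1, upperHeight r y = 1 := by
  rw [intervalIntegral.integral_congr (g := fun _ => 1) fun y hy => ?_]
  · simp
  · rw [Set.uIcc_of_le zero_le_one] at hy
    exact upperHeight_of_le (by nlinarith [hy.1, hy.2])

lemma integral_one_sub (a b : ℝ) :
    ∫ y in a..b, (1 - y) = (b - b ^ 2 / 2) - (a - a ^ 2 / 2) := by
  rw [intervalIntegral.integral_sub (by simp) (by simp)]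
  simp
  ring

lemma integral_inv_mul_inv (r : ℝ) {a b : ℝ} (ha : 0 < a) (hb : 0 < b) :
    ∫ y in a..b, r⁻¹ * y⁻¹ = r⁻¹ * (Real.log b - Real.log a) := by
  rw [intervalIntegral.integral_const_mul, integral_inv_of_pos ha hb, Real.log_div hb.ne' ha.ne']

lemma integral_upperHeight_of_one_le {r : ℝ} (hr1 : 1 ≤ r) :
    ∫ y in (0 : ℝ)..1, upperHeight r y = r⁻¹ + r⁻¹ * Real.log r := by
  have hr : 0 < r := by linarith
  have hr' : r⁻¹ ≤ 1 := inv_le_one_of_one_le₀ hr1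
  have hr'' : 0 < r⁻¹ := inv_pos.2 hr
  have hmul : r * r⁻¹ = 1 := mul_inv_cancel₀ hr.ne'
  rw [← intervalIntegral.integral_add_adjacent_intervals
    ((continuous_upperHeight r).intervalIntegrable 0 r⁻¹)
    ((continuous_upperHeight r).intervalIntegrable r⁻¹ 1),
    intervalIntegral.integral_congr (g := fun _ => 1) fun y hy => ?_,
    intervalIntegral.integral_congr (a := r⁻¹) (g := fun y => r⁻¹ * y⁻¹) fun y hy => ?_,
    integral_inv_mul_inv r hr'' one_pos, Real.log_inv]
  · simp
  · rw [Set.uIcc_of_le hr'] at hy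
    refine upperHeight_of_ge ?_
    rw [← hmul]; exact mul_le_mul_of_nonneg_left hy.1 hr.le
  · rw [Set.uIcc_of_le hr''.le] at hy
    refine upperHeight_of_le ?_
    rw [← hmul]; exact mul_le_mul_of_nonneg_left hy.2 hr.le

/-- Since `y (1 - y) ≤ 1/4`, the hyperbola does not cross the line `y + v = 1` for `r ≤ 4`. -/
lemma integral_lowerHeight_of_le_four {r : ℝ} (hr : r ≤ 4) :
    ∫ y in (0 : ℝ)..1, lowerHeight r y = 1 / 2 := by
  rw [intervalIntegral.integral_congr (g := fun y => 1 - y) fun y hy => ?_, integral_one_sub]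
  · norm_num
  · rw [Set.uIcc_of_le zero_le_one] at hy
    have h : 0 ≤ y * (1 - y) := mul_nonneg hy.1 (by linarith [hy.2])
    exact lowerHeight_of_le hy.1 (by nlinarith [sq_nonneg (y - 1 / 2)])

/-- The hyperbola meets the line `y + v = 1` at `y = q` and `y = 1 - q`, and lies below it in
between. The relation `hqr` serves to eliminate `log q`. -/
lemma integral_lowerHeight_of_mul_eq {r q : ℝ} (hr : 0 < r) (hq0 : 0 < q) (hq : q ≤ 1 / 2)
    (hqr : r * q * (1 - q) = 1) :
    ∫ y in (0 : ℝ)..1, lowerHeight r y =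
      q + r⁻¹ * (2 * Real.log (1 - q) + Real.log r) := by
  have hlog : Real.log r + Real.log q + Real.log (1 - q) = 0 := by
    rw [← Real.log_mul hr.ne' hq0.ne', ← Real.log_mul (by positivity) (by linarith), hqr,
      Real.log_one]
  have hi := fun a b => (continuous_lowerHeight r).intervalIntegrable (μ := volume) a b
  rw [← intervalIntegral.integral_add_adjacent_intervals (hi 0 q) (hi q 1),
    ← intervalIntegral.integral_add_adjacent_intervals (hi q (1 - q)) (hi (1 - q) 1),
    intervalIntegral.integral_congr (a := 0) (g := fun y => 1 - y) fun y hy => ?_,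
    intervalIntegral.integral_congr (a := q) (g := fun y => r⁻¹ * y⁻¹) fun y hy => ?_,
    intervalIntegral.integral_congr (a := 1 - q) (g := fun y => 1 - y) fun y hy => ?_,
    integral_inv_mul_inv r hq0 (by linarith), integral_one_sub, integral_one_sub]
  · linear_combination (-r⁻¹) * hlog
  · rw [Set.uIcc_of_le (by linarith)] at hy
    have : 0 ≤ (y - q) * (y - (1 - q)) :=
      mul_nonneg (by linarith [hy.1]) (by linarith [hy.1])
    exact lowerHeight_of_le (by linarith [hy.1]) (by nlinarith)
  · rw [Set.uIcc_of_le (by linarith)] at hy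
    have : 0 ≤ (y - q) * ((1 - q) - y) :=
      mul_nonneg (by linarith [hy.1]) (by linarith [hy.2])
    exact lowerHeight_of_ge hr.le (by linarith [hy.1]) (by nlinarith)
  · rw [Set.uIcc_of_le hq0.le] at hy
    have : 0 ≤ (q - y) * ((1 - q) - y) :=
      mul_nonneg (by linarith [hy.2]) (by linarith [hy.2])
    exact lowerHeight_of_le hy.1 (by nlinarith)

lemma triangleArea_of_le_one {r : ℝ} (hr : r ≤ 1) : triangleArea r = 1 := by
  rw [triangleArea_eq, integral_upperHeight_of_le_one hr,
    integral_lowerHeight_of_le_four (by linarith)]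
  norm_num

lemma triangleArea_of_le_four {r : ℝ} (hr : 1 ≤ r) (hr4 : r ≤ 4) :
    triangleArea r = -1 + 2 * r⁻¹ + 2 * r⁻¹ * Real.log r := by
  rw [triangleArea_eq, integral_upperHeight_of_one_le hr, integral_lowerHeight_of_le_four hr4]
  ring

lemma triangleArea_of_mul_eq {r q : ℝ} (hr : 1 ≤ r) (hq0 : 0 < q) (hq : q ≤ 1 / 2)
    (hqr : r * q * (1 - q) = 1) :
    triangleArea r = 2 * r⁻¹ - 2 * q - 4 * r⁻¹ * Real.log (1 - q) := by
  rw [triangleArea_eq, integral_upperHeight_of_one_le hr,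
    integral_lowerHeight_of_mul_eq (by linarith) hq0 hq hqr]
  ring

/-- The smaller root of `q (1 - q) = 1 / r`. -/
noncomputable def smallRoot (r : ℝ) : ℝ := 1 / 2 - Real.sqrt (1 / 4 - r⁻¹)

lemma smallRoot_le (r : ℝ) : smallRoot r ≤ 1 / 2 :=
  sub_le_self _ (Real.sqrt_nonneg _)

lemma smallRoot_pos {r : ℝ} (hr : 0 < r) : 0 < smallRoot r := by
  rw [smallRoot, sub_pos, Real.sqrt_lt' (by norm_num)]
  have := inv_pos.2 hr
  linarith

lemma mul_smallRoot {r : ℝ} (hr : 4 ≤ r) : r * smallRoot r * (1 - smallRoot r) = 1 := by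
  have h4 : r⁻¹ ≤ 1 / 4 := by
    rw [← one_div]; exact one_div_le_one_div_of_le (by norm_num) hr
  have hs := Real.sq_sqrt (show 0 ≤ 1 / 4 - r⁻¹ by linarith)
  have hmul : r * r⁻¹ = 1 := mul_inv_cancel₀ (by linarith)
  rw [smallRoot]
  linear_combination (-r) * hs + hmul

lemma triangleArea_of_four_le {r : ℝ} (hr : 4 ≤ r) :
    triangleArea r = -1 + 2 * r⁻¹ + 2 * Real.sqrt (1 / 4 - r⁻¹)
      - 4 * r⁻¹ * Real.log (1 / 2 + Real.sqrt (1 / 4 - r⁻¹)) := by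
  rw [triangleArea_of_mul_eq (by linarith) (smallRoot_pos (by linarith)) (smallRoot_le r)
    (mul_smallRoot hr), smallRoot]
  ring_nf

/-! ### Tail asymptotics -/

lemma tendsto_smallRoot : Tendsto smallRoot atTop (𝓝[≠] 0) := by
  refine tendsto_nhdsWithin_iff.2 ⟨?_, ?_⟩
  · have h : Tendsto (fun r : ℝ => 1 / 2 - Real.sqrt (1 / 4 - r⁻¹)) atTop
        (𝓝 (1 / 2 - Real.sqrt (1 / 4 - 0))) :=
      ((tendsto_inv_atTop_zero.const_sub _).sqrt).const_sub _
    have hs : Real.sqrt (1 / 4) = 1 / 2 := by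
      rw [show (1 / 4 : ℝ) = (1 / 2) ^ 2 by norm_num, Real.sqrt_sq (by norm_num)]
    rwa [sub_zero, hs, sub_self] at h
  · filter_upwards [eventually_gt_atTop 0] with r hr using (smallRoot_pos hr).ne'

/-- With `r = 1/(q (1 - q))` the expression becomes a function of the small root `q → 0`, free of
square roots. Only the derivative of `log (1 - q)` at `0` is then needed, and the limit is `-2 + 4`.
-/
lemma tendsto_triangleArea_mul_sq :
    Tendsto (fun r => triangleArea r * r ^ 2) atTop (𝓝 2) := by
  have hlog : Tendsto (fun q : ℝ => q⁻¹ * Real.log (1 - q)) (𝓝[≠] 0) (𝓝 (-1)) := by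
    have hd : HasDerivAt (fun q : ℝ => Real.log (1 - q)) (-1) 0 := by
      simpa using ((hasDerivAt_id (0 : ℝ)).const_sub 1).log (by simp)
    simpa using hasDerivAt_iff_tendsto_slope_zero.1 hd
  have hid : Tendsto (fun q : ℝ => 1 - q) (𝓝[≠] 0) (𝓝 1) := by
    simpa using ((tendsto_id (x := 𝓝 (0 : ℝ))).mono_left nhdsWithin_le_nhds).const_sub (1 : ℝ)
  have hlim : Tendsto (fun q : ℝ => (-2 - 4 * (1 - q) * (q⁻¹ * Real.log (1 - q))) / (1 - q) ^ 2)
      (𝓝[≠] 0) (𝓝 2) := by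
    have := (((hid.const_mul 4).mul hlog).const_sub (-2)).div (hid.pow 2) (by norm_num)
    norm_num at this
    exact this
  refine (hlim.comp tendsto_smallRoot).congr' ?_
  filter_upwards [eventually_ge_atTop 4] with r hr
  have h0 := smallRoot_pos (show 0 < r by linarith)
  have h1 : 0 < 1 - smallRoot r := by linarith [smallRoot_le r]
  have hr0 : r = 1 / (smallRoot r * (1 - smallRoot r)) := by
    rw [eq_div_iff (by positivity), ← mul_assoc, mul_smallRoot hr]
  rw [triangleArea_of_mul_eq (by linarith) h0 (smallRoot_le r) (mul_smallRoot hr),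
    Function.comp_apply]
  generalize smallRoot r = q at *
  subst hr0
  field_simp
  ring

lemma hittingDensity_isEquivalent :
    hittingDensity ~[atTop] fun r : ℝ => 6 / Real.pi ^ 2 * (r ^ 2)⁻¹ := by
  refine isEquivalent_of_tendsto_one ?_
  have h := tendsto_triangleArea_mul_sq.div_const 2
  rw [div_self two_ne_zero] at h
  refine h.congr' ?_
  filter_upwards [eventually_gt_atTop 0] with r hr
  have := Real.pi_pos
  rw [Pi.div_apply, hittingDensity_eq]
  field_simp
  ring

lemma extremeDensity_isEquivalent :
    extremeDensity ~[atBot] fun s : ℝ => 6 / Real.pi ^ 2 * Real.exp (-|s|) := by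
  have h := (IsEquivalent.refl (u := fun s : ℝ => Real.exp (-s)) (l := atBot)).mul
    (hittingDensity_isEquivalent.comp_tendsto
      (Real.tendsto_exp_atTop.comp tendsto_neg_atBot_atTop))
  refine h.congr_right ?_
  filter_upwards [eventually_le_atBot 0] with s hs
  simp only [Pi.mul_apply, Function.comp_apply]
  rw [abs_of_nonpos hs, neg_neg, Real.exp_neg]
  field_simp

/-! ### Consecutive Farey fractions and their denominators -/

/-- Pairs of fractions of level `N` with determinant one and denominators adding to more
than `N`. -/
def IsFareyNeighbour (N : ℕ) (x y : ℚ) : Prop :=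
  0 ≤ x ∧ y ≤ 1 ∧ x.den ≤ N ∧ y.den ≤ N ∧ y.num * x.den - x.num * y.den = 1 ∧ N < x.den + y.den

lemma IsFareyNeighbour.lt {N : ℕ} {x y : ℚ} (h : IsFareyNeighbour N x y) : x < y := by
  rw [Rat.lt_iff]; linarith [h.2.2.2.2.1]

lemma IsFareyNeighbour.mem_fareyPairs {N : ℕ} {x y : ℚ} (h : IsFareyNeighbour N x y) :
    (x, y) ∈ fareyPairs N := by
  have hlt := h.lt
  obtain ⟨h0, h1, hx, hy, hdet, hN⟩ := h
  refine ⟨⟨h0, hlt.le.trans h1, hx⟩, ⟨h0.trans hlt.le, h1, hy⟩, hlt, ?_⟩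
  rintro z ⟨-, -, hz⟩ ⟨hxz, hzy⟩
  rw [Rat.lt_iff] at hxz hzy
  -- By Cramer's rule the denominator of a fraction strictly between is a combination of the two
  -- denominators with coefficients at least `1`, hence exceeds `N`.
  have e : (z.den : ℤ) = x.den * (y.num * z.den - z.num * y.den)
      + y.den * (z.num * x.den - x.num * z.den) := by linear_combination (-(z.den : ℤ)) * hdet
  have hx0 : (0 : ℤ) < x.den := by exact_mod_cast x.den_pos
  have hy0 : (0 : ℤ) < y.den := by exact_mod_cast y.den_pos
  zify at hN hz
  nlinarith

/-- The solutions `b` form a residue class modulo `q`, so one lies in any half-open window of length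
`q`. -/
lemma exists_det_eq_one {p q : ℤ} (hq : 0 < q) (h : IsCoprime p q) (n : ℤ) :
    ∃ a b : ℤ, a * q - p * b = 1 ∧ n - q < b ∧ b ≤ n := by
  obtain ⟨u, v, huv⟩ := h
  have h1 := Int.emod_add_mul_ediv (n + u) q
  have h2 := Int.emod_nonneg (n + u) hq.ne'
  have h3 := Int.emod_lt_of_pos (n + u) hq
  refine ⟨v + p * ((n + u) / q), -u + q * ((n + u) / q), ?_, ?_, ?_⟩
  · linear_combination huv
  · linarith
  · linarith

lemma exists_rat_num_den {a b : ℤ} (hb : 0 < b) (h : IsCoprime a b) :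
    ∃ z : ℚ, z.num = a ∧ (z.den : ℤ) = b := by
  have h' : Nat.Coprime a.natAbs b.natAbs := Int.isCoprime_iff_gcd_eq_one.1 h
  exact ⟨a / b, Rat.num_div_eq_of_coprime hb h', Rat.den_div_eq_of_coprime hb h'⟩

lemma rat_le_one_iff (x : ℚ) : x ≤ 1 ↔ x.num ≤ x.den := by
  rw [Rat.le_iff]; simp

lemma rat_lt_one_iff (x : ℚ) : x < 1 ↔ x.num < x.den := by
  rw [Rat.lt_iff]; simp

/-- A determinant-one neighbour `z` of `x` with denominator in `(N - x.den, N]` is itself the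
successor of `x`, so it must be `y`. -/
lemma mem_fareyPairs_iff {N : ℕ} {x y : ℚ} :
    (x, y) ∈ fareyPairs N ↔ IsFareyNeighbour N x y := by
  refine ⟨?_, IsFareyNeighbour.mem_fareyPairs⟩
  rintro ⟨⟨hx0, -, hxN⟩, hyF, hxy, hbetween⟩
  have hx1 : x < 1 := lt_of_lt_of_le hxy hyF.2.1
  have hq : (0 : ℤ) < x.den := by exact_mod_cast x.den_pos
  have hcop : IsCoprime x.num (x.den : ℤ) := Int.isCoprime_iff_gcd_eq_one.2 x.reduced
  obtain ⟨a, b, hab, hb1, hb2⟩ := exists_det_eq_one hq hcop N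
  have hxN' : (x.den : ℤ) ≤ N := by exact_mod_cast hxN
  have hb0 : 0 < b := by linarith
  obtain ⟨z, hza, hzb⟩ := exists_rat_num_den (a := a) hb0 ⟨x.den, -x.num, by linarith⟩
  have hn0 : 0 ≤ x.num := Rat.num_nonneg.2 hx0
  have hn1 : x.num < x.den := (rat_lt_one_iff x).1 hx1
  have hz : IsFareyNeighbour N x z := by
    refine ⟨hx0, ?_, hxN, ?_, ?_, ?_⟩
    · rw [rat_le_one_iff, hza, hzb]
      nlinarith
    · zify; rw [hzb]; exact hb2
    · rw [hza, hzb]; exact hab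
    · zify; rw [hzb]; linarith
  have hz' := hz.mem_fareyPairs
  rcases lt_trichotomy y z with h | h | h
  · exact absurd ⟨hxy, h⟩ (hz'.2.2.2 y hyF)
  · rwa [h]
  · exact absurd ⟨hz.lt, h⟩ (hbetween z hz'.2.1)

lemma IsFareyNeighbour.sub_eq {N : ℕ} {x y : ℚ} (h : IsFareyNeighbour N x y) :
    (y : ℝ) - x = 1 / (x.den * y.den) := by
  have hx : (x.den : ℝ) ≠ 0 := by exact_mod_cast x.den_ne_zero
  have hy : (y.den : ℝ) ≠ 0 := by exact_mod_cast y.den_ne_zero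
  have hdet : (y.num * x.den - x.num * y.den : ℝ) = 1 := by exact_mod_cast h.2.2.2.2.1
  rw [Rat.cast_def x, Rat.cast_def y]
  field_simp
  linarith

open Classical in
/-- The coprime pairs `(a, b)` with `a, b ≤ N < a + b` and `r a b < N²`. -/
noncomputable def coprimePairs (N : ℕ) (r : ℝ) : Finset (ℕ × ℕ) :=
  {p ∈ Finset.Icc 1 N ×ˢ Finset.Icc 1 N |
    p.1.Coprime p.2 ∧ (N : ℝ) < p.1 + p.2 ∧ r * p.1 * p.2 < (N : ℝ) ^ 2}

lemma mem_coprimePairs {N : ℕ} {r : ℝ} {a b : ℕ} :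
    (a, b) ∈ coprimePairs N r ↔ ((1 ≤ a ∧ a ≤ N) ∧ 1 ≤ b ∧ b ≤ N) ∧
      a.Coprime b ∧ (N : ℝ) < a + b ∧ r * a * b < (N : ℝ) ^ 2 := by
  simp [coprimePairs]

lemma IsFareyNeighbour.coprime_den {N : ℕ} {x y : ℚ} (h : IsFareyNeighbour N x y) :
    x.den.Coprime y.den := by
  rw [← Nat.isCoprime_iff_coprime]
  exact ⟨y.num, -x.num, by linarith [h.2.2.2.2.1]⟩

/-- The determinant relation fixes `x.num` modulo `x.den`, and `0 ≤ x.num < x.den` because `x < 1`.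
-/
lemma injOn_den_fareyPairs (N : ℕ) :
    Set.InjOn (fun p : ℚ × ℚ => (p.1.den, p.2.den)) (fareyPairs N) := by
  rintro ⟨x, y⟩ h ⟨x', y'⟩ h' hd
  rw [mem_fareyPairs_iff] at h h'
  obtain ⟨hdx, hdy⟩ := Prod.mk.inj hd
  simp only at hdx hdy
  have hcop := h.coprime_den
  have hlt := (rat_lt_one_iff x).1 (h.lt.trans_le h.2.1)
  have hlt' := (rat_lt_one_iff x').1 (h'.lt.trans_le h'.2.1)
  have h0 := Rat.num_nonneg.2 h.1
  have h0' := Rat.num_nonneg.2 h'.1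
  have hdet := h.2.2.2.2.1
  have hdet' := h'.2.2.2.2.1
  rw [← hdx] at hlt' hdet'
  rw [← hdy] at hdet'
  have hdvd : (x.den : ℤ) ∣ x.num - x'.num := by
    refine IsCoprime.dvd_of_dvd_mul_right (Nat.isCoprime_iff_coprime.2 hcop)
      ⟨y.num - y'.num, ?_⟩
    linear_combination hdet' - hdet
  have hxn : x.num = x'.num := by
    refine sub_eq_zero.1 (Int.eq_zero_of_abs_lt_dvd hdvd ?_)
    rw [abs_lt]
    constructor <;> linarith
  have hyn : y.num = y'.num := by
    have hx0 : (x.den : ℤ) ≠ 0 := by exact_mod_cast x.den_ne_zero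
    refine mul_right_cancel₀ hx0 ?_
    rw [hxn] at hdet
    linarith
  exact Prod.ext (Rat.ext hxn hdx) (Rat.ext hyn hdy)

lemma IsFareyNeighbour.lt_sq_mul_sub_iff {N : ℕ} {x y : ℚ} (h : IsFareyNeighbour N x y) (r : ℝ) :
    r < (N : ℝ) ^ 2 * ((y : ℝ) - x) ↔ r * x.den * y.den < (N : ℝ) ^ 2 := by
  have hx : (0 : ℝ) < x.den := by exact_mod_cast x.den_pos
  have hy : (0 : ℝ) < y.den := by exact_mod_cast y.den_pos
  rw [h.sub_eq, mul_one_div, lt_div_iff₀ (by positivity), mul_assoc]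

lemma image_den_fareyPairs (N : ℕ) (r : ℝ) :
    (fun p : ℚ × ℚ => (p.1.den, p.2.den)) ''
      {p ∈ fareyPairs N | r < (N : ℝ) ^ 2 * ((p.2 : ℝ) - (p.1 : ℝ))} = coprimePairs N r := by
  ext ⟨a, b⟩
  rw [Finset.mem_coe, mem_coprimePairs]
  constructor
  · rintro ⟨⟨x, y⟩, ⟨h, hr⟩, hd⟩
    obtain ⟨rfl, rfl⟩ := Prod.mk.inj hd
    rw [mem_fareyPairs_iff] at h
    exact ⟨⟨⟨x.den_pos, h.2.2.1⟩, y.den_pos, h.2.2.2.1⟩, h.coprime_den,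
      by exact_mod_cast h.2.2.2.2.2, (h.lt_sq_mul_sub_iff r).1 hr⟩
  · rintro ⟨⟨⟨ha, haN⟩, hb, hbN⟩, hcop, hN, hr⟩
    -- The window ending at `a - 1` places the numerator `p` in `[0, a - 1]`, which keeps both
    -- fractions `p/a` and `c/b` in `[0, 1]`.
    obtain ⟨c, p, hcp, hp1, hp2⟩ := exists_det_eq_one (p := b) (q := a)
      (by exact_mod_cast ha) (Nat.isCoprime_iff_coprime.2 hcop.symm) (a - 1)
    have ha' : (1 : ℤ) ≤ a := by exact_mod_cast ha
    have hb' : (1 : ℤ) ≤ b := by exact_mod_cast hb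
    have hp0 : 0 ≤ p := by linarith
    obtain ⟨x, hxn, hxd⟩ := exists_rat_num_den (a := p) (b := a) (by linarith)
      ⟨-b, c, by linarith⟩
    obtain ⟨y, hyn, hyd⟩ := exists_rat_num_den (a := c) (b := b) (by linarith)
      ⟨a, -p, by linarith⟩
    have hxd' : x.den = a := by exact_mod_cast hxd
    have hyd' : y.den = b := by exact_mod_cast hyd
    have h : IsFareyNeighbour N x y := by
      refine ⟨Rat.num_nonneg.1 (by rwa [hxn]), ?_, by rwa [hxd'], by rwa [hyd'], ?_, ?_⟩
      · rw [rat_le_one_iff, hyn, hyd]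
        nlinarith
      · rw [hxn, hxd, hyn, hyd]; linarith
      · rw [hxd', hyd']; exact_mod_cast hN
    refine ⟨(x, y), ⟨h.mem_fareyPairs, (h.lt_sq_mul_sub_iff r).2 (by rwa [hxd', hyd'])⟩, ?_⟩
    simp only [hxd', hyd']

lemma ncard_fareyPairs_lt (N : ℕ) (r : ℝ) :
    {p ∈ fareyPairs N | r < (N : ℝ) ^ 2 * ((p.2 : ℝ) - (p.1 : ℝ))}.ncard =
      (coprimePairs N r).card := by
  rw [← Set.ncard_coe_finset, ← image_den_fareyPairs,
    ((injOn_den_fareyPairs N).mono (Set.sep_subset _ _)).ncard_image]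

lemma fareyGapTail_eq {N : ℕ} (hN : 0 < N) (r : ℝ) :
    fareyGapTail N r = (coprimePairs N r).card / (coprimePairs N 0).card := by
  have h : fareyPairs N =
      {p ∈ fareyPairs N | 0 < (N : ℝ) ^ 2 * ((p.2 : ℝ) - (p.1 : ℝ))} := by
    refine (Set.sep_eq_self_iff_mem_true.2 fun p hp => ?_).symm
    have : (p.1 : ℝ) < p.2 := by exact_mod_cast hp.2.2.1
    have : 0 < (p.2 : ℝ) - p.1 := sub_pos.2 this
    positivity
  rw [fareyGapTail, ncard_fareyPairs_lt, ← ncard_fareyPairs_lt N 0, ← h]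

/-! ### Counting lattice points in the scaled triangle -/

lemma abs_card_sub_le_one {S : Finset ℕ} {β : ℝ} (hβ : 0 ≤ β)
    (h1 : ∀ b ∈ S, 1 ≤ b ∧ (b : ℝ) ≤ β) (h2 : ∀ b : ℕ, 1 ≤ b → (b : ℝ) < β → b ∈ S) :
    |(S.card : ℝ) - β| ≤ 1 := by
  have hub : S.card ≤ ⌊β⌋₊ := by
    simpa using Finset.card_le_card (show S ⊆ Finset.Icc 1 ⌊β⌋₊ from fun b hb =>
      Finset.mem_Icc.2 ⟨(h1 b hb).1, Nat.le_floor (h1 b hb).2⟩)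
  have hlb : ⌈β⌉₊ - 1 ≤ S.card := by
    simpa using Finset.card_le_card (show Finset.Ico 1 ⌈β⌉₊ ⊆ S from fun b hb =>
      h2 b (Finset.mem_Ico.1 hb).1 (Nat.lt_ceil.1 (Finset.mem_Ico.1 hb).2))
  have h3 : (S.card : ℝ) ≤ β := (Nat.cast_le.2 hub).trans (Nat.floor_le hβ)
  have h4 : (⌈β⌉₊ : ℝ) ≤ S.card + 1 := by exact_mod_cast Nat.sub_le_iff_le_add.1 hlb
  have h5 := Nat.le_ceil β
  rw [abs_le]
  constructor <;> linarith

lemma card_filter_product (n : ℕ) (P : ℕ → ℕ → Prop) [∀ a b, Decidable (P a b)] :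
    ({p ∈ Finset.Icc 1 n ×ˢ Finset.Icc 1 n | P p.1 p.2} : Finset (ℕ × ℕ)).card =
      ∑ a ∈ Finset.Icc 1 n, ({b ∈ Finset.Icc 1 n | P a b} : Finset ℕ).card := by
  simp_rw [Finset.card_filter]
  rw [Finset.sum_product]

/-- Left and right sums of an antitone function enclose the integral and differ by at most `M`. The
leftover interval from `⌊M⌋₊ / M` to `1` costs at most another `M`. -/
lemma abs_sum_sub_integral_le {g : ℝ → ℝ} (hg : AntitoneOn g (Set.Icc 0 1))
    (hg0 : ∀ x ∈ Set.Icc (0 : ℝ) 1, g x ∈ Set.Icc (0 : ℝ) 1) {M : ℝ} (hM : 0 < M) :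
    |∑ a ∈ Finset.Icc 1 ⌊M⌋₊, M * g (a / M) - M ^ 2 * ∫ x in (0 : ℝ)..1, g x| ≤ 2 * M := by
  set n := ⌊M⌋₊ with hn
  have hnM : (n : ℝ) ≤ M := Nat.floor_le hM.le
  have hnM' : M < n + 1 := Nat.lt_floor_add_one M
  have hmem : ∀ x ∈ Set.Icc (0 : ℝ) (0 + n), x / M ∈ Set.Icc (0 : ℝ) 1 := fun x hx =>
    ⟨div_nonneg hx.1 hM.le, div_le_one_of_le₀ (by linarith [hx.2]) hM.le⟩
  have hf : AntitoneOn (fun x => M * g (x / M)) (Set.Icc 0 (0 + n)) := fun x hx y hy hxy =>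
    mul_le_mul_of_nonneg_left (hg (hmem x hx) (hmem y hy) (by gcongr)) hM.le
  have h1 := hf.sum_le_integral
  have h2 := hf.integral_le_sum
  have hsum : ∑ a ∈ Finset.Icc 1 n, M * g (a / M) =
      ∑ i ∈ Finset.range n, M * g (((i + 1 : ℕ) : ℝ) / M) := by
    rw [Finset.range_eq_Ico, Finset.sum_Ico_add' (fun i : ℕ => M * g ((i : ℝ) / M)), zero_add]
    rfl
  have htel := Finset.sum_range_sub (fun i : ℕ => M * g ((i : ℝ) / M)) n
  rw [Finset.sum_sub_distrib] at htel
  simp only [zero_add] at h1 h2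
  have hint : ∫ x in (0 : ℝ)..n, M * g (x / M) = M ^ 2 * ∫ x in (0 : ℝ)..(n / M), g x := by
    rw [intervalIntegral.integral_const_mul, intervalIntegral.integral_comp_div _ hM.ne',
      smul_eq_mul, zero_div]
    ring
  have hn1 : (n : ℝ) / M ∈ Set.Icc (0 : ℝ) 1 := hmem n ⟨by positivity, by simp⟩
  have hi : IntervalIntegrable g volume 0 1 :=
    AntitoneOn.intervalIntegrable (by rwa [Set.uIcc_of_le zero_le_one])
  have hi1 : IntervalIntegrable g volume 0 (n / M) := hi.mono_set (by
    rw [Set.uIcc_of_le zero_le_one, Set.uIcc_of_le hn1.1]; exact Set.Icc_subset_Icc_right hn1.2)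
  have hi2 : IntervalIntegrable g volume (n / M) 1 := hi.mono_set (by
    rw [Set.uIcc_of_le zero_le_one, Set.uIcc_of_le hn1.2]; exact Set.Icc_subset_Icc_left hn1.1)
  have hsplit := intervalIntegral.integral_add_adjacent_intervals hi1 hi2
  have ht0 : 0 ≤ ∫ x in (n / M)..1, g x := intervalIntegral.integral_nonneg hn1.2 fun x hx =>
    (hg0 x ⟨hn1.1.trans hx.1, hx.2⟩).1
  have ht1 : ∫ x in (n / M)..1, g x ≤ ∫ _ in (n / M)..1, (1 : ℝ) :=
    intervalIntegral.integral_mono_on hn1.2 hi2 (by simp) fun x hx =>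
      (hg0 x ⟨hn1.1.trans hx.1, hx.2⟩).2
  rw [intervalIntegral.integral_const, smul_eq_mul, mul_one] at ht1
  have hM2 : M ^ 2 * (1 - n / M) ≤ M := by
    have : M ^ 2 * (1 - n / M) = M * (M - n) := by field_simp
    rw [this]; nlinarith
  have ht2 : M ^ 2 * ∫ x in (n / M)..1, g x ≤ M :=
    (mul_le_mul_of_nonneg_left ht1 (by positivity)).trans hM2
  have ht3 : 0 ≤ M ^ 2 * ∫ x in (n / M)..1, g x := by positivity
  have hgn : 0 ≤ M * g ((n : ℝ) / M) := mul_nonneg hM.le (hg0 _ hn1).1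
  have hgz : M * g (((0 : ℕ) : ℝ) / M) ≤ M := by
    have := (hg0 (((0 : ℕ) : ℝ) / M) (by simp)).2
    nlinarith
  rw [hint] at h1 h2
  rw [hsum, ← hsplit, mul_add, abs_le]
  constructor <;> linarith

/-- Counting by columns, each of the at most `M` columns contributes an error of at most `1`. Points
on the graph may be counted or not, so strict and weak inequalities are treated alike. -/
lemma abs_card_sub_integral_le {g : ℝ → ℝ} (hg : AntitoneOn g (Set.Icc 0 1))
    (hg0 : ∀ x ∈ Set.Icc (0 : ℝ) 1, g x ∈ Set.Icc (0 : ℝ) 1) {M : ℝ} (hM : 0 < M)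
    {P : ℕ → ℕ → Prop} [∀ a b, Decidable (P a b)]
    (h1 : ∀ a b : ℕ, 1 ≤ a → (a : ℝ) ≤ M → 1 ≤ b → (b : ℝ) ≤ M → P a b → (b : ℝ) ≤ M * g (a / M))
    (h2 : ∀ a b : ℕ, 1 ≤ a → (a : ℝ) ≤ M → 1 ≤ b → (b : ℝ) < M * g (a / M) → P a b) :
    |(({p ∈ Finset.Icc 1 ⌊M⌋₊ ×ˢ Finset.Icc 1 ⌊M⌋₊ | P p.1 p.2} : Finset (ℕ × ℕ)).card : ℝ) -
      M ^ 2 * ∫ x in (0 : ℝ)..1, g x| ≤ 3 * M := by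
  have hcol : |(({p ∈ Finset.Icc 1 ⌊M⌋₊ ×ˢ Finset.Icc 1 ⌊M⌋₊ | P p.1 p.2} :
      Finset (ℕ × ℕ)).card : ℝ) - ∑ a ∈ Finset.Icc 1 ⌊M⌋₊, M * g (a / M)| ≤ M := by
    rw [card_filter_product ⌊M⌋₊ P, Nat.cast_sum, ← Finset.sum_sub_distrib]
    refine (Finset.abs_sum_le_sum_abs _ _).trans ((Finset.sum_le_card_nsmul _ _ 1 ?_).trans ?_)
    · intro a ha
      rw [Finset.mem_Icc] at ha
      have haM : (a : ℝ) ≤ M := (Nat.le_floor_iff hM.le).1 ha.2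
      have hga := hg0 (a / M) ⟨by positivity, div_le_one_of_le₀ haM hM.le⟩
      refine abs_card_sub_le_one (mul_nonneg hM.le hga.1) (fun b hb => ?_) fun b hb1 hb => ?_
      · rw [Finset.mem_filter, Finset.mem_Icc] at hb
        exact ⟨hb.1.1, h1 a b ha.1 haM hb.1.1 ((Nat.le_floor_iff hM.le).1 hb.1.2) hb.2⟩
      · rw [Finset.mem_filter, Finset.mem_Icc]
        have : (b : ℝ) ≤ M := hb.le.trans (mul_le_of_le_one_right hM.le hga.2)
        exact ⟨⟨hb1, Nat.le_floor this⟩, h2 a b ha.1 haM hb1 hb⟩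
    · simpa using Nat.floor_le hM.le
  have h := abs_sum_sub_integral_le hg hg0 hM
  rw [abs_le] at *
  constructor <;> linarith

open Classical in
/-- The pairs of positive integers `(a, b)` with `a, b ≤ M < a + b` and `r a b < M²`. -/
noncomputable def trianglePairs (r M : ℝ) : Finset (ℕ × ℕ) :=
  {p ∈ Finset.Icc 1 ⌊M⌋₊ ×ˢ Finset.Icc 1 ⌊M⌋₊ | M < p.1 + p.2 ∧ r * p.1 * p.2 < M ^ 2}

lemma mem_trianglePairs {r M : ℝ} {a b : ℕ} : (a, b) ∈ trianglePairs r M ↔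
    ((1 ≤ a ∧ a ≤ ⌊M⌋₊) ∧ 1 ≤ b ∧ b ≤ ⌊M⌋₊) ∧ M < a + b ∧ r * a * b < M ^ 2 := by
  simp [trianglePairs]

lemma antitone_upperHeight {r : ℝ} (hr : 0 ≤ r) : Antitone (upperHeight r) := fun _ _ hxy =>
  one_div_le_one_div_of_le (zero_lt_one.trans_le (le_max_left _ _))
    (max_le_max_left _ (mul_le_mul_of_nonneg_left hxy hr))

lemma antitone_lowerHeight {r : ℝ} (hr : 0 ≤ r) : Antitone (lowerHeight r) := fun _ _ hxy =>
  min_le_min (by linarith) (antitone_upperHeight hr hxy)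

/-- The region is not under an antitone graph, but it is the difference of two such regions, bounded
by `upperHeight` and `lowerHeight`; each contributes an error `3 M`. -/
lemma abs_card_trianglePairs_sub_le {r : ℝ} (hr : 0 ≤ r) {M : ℝ} (hM : 0 < M) :
    |((trianglePairs r M).card : ℝ) - M ^ 2 * (triangleArea r / 2)| ≤ 6 * M := by
  classical
  have hscale : ∀ a b : ℕ, r * (a / M) * (b / M) = r * a * b / M ^ 2 := fun a b => by
    field_simp
  have hU := abs_card_sub_integral_le ((antitone_upperHeight hr).antitoneOn _)
    (fun x _ => ⟨(upperHeight_pos r x).le, upperHeight_le_one r x⟩) hM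
    (P := fun a b => r * a * b < M ^ 2)
    (fun a b _ _ hb hbM h => by
      rw [← div_le_iff₀' hM, le_upperHeight_iff (by positivity), hscale]
      exact ⟨div_le_one_of_le₀ hbM hM.le, div_le_one_of_le₀ h.le (by positivity)⟩)
    (fun a b _ _ hb h => by
      rw [← div_lt_iff₀' hM, lt_upperHeight_iff (by positivity), hscale,
        div_lt_one (by positivity : 0 < M ^ 2)] at h
      exact h.2)
  have hL := abs_card_sub_integral_le ((antitone_lowerHeight hr).antitoneOn _)
    (fun x hx => ⟨le_min (by linarith [hx.2]) (upperHeight_pos r x).le,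
      (min_le_right _ _).trans (upperHeight_le_one r x)⟩) hM
    (P := fun a b => r * a * b < M ^ 2 ∧ ¬ M < a + b)
    (fun a b _ _ hb hbM h => by
      rw [← div_le_iff₀' hM, lowerHeight, le_min_iff, le_upperHeight_iff (by positivity), hscale]
      refine ⟨?_, div_le_one_of_le₀ hbM hM.le, div_le_one_of_le₀ h.1.le (by positivity)⟩
      rw [le_sub_iff_add_le, ← add_div]
      exact div_le_one_of_le₀ (by linarith [not_lt.1 h.2]) hM.le)
    (fun a b _ _ hb h => by
      rw [← div_lt_iff₀' hM, lowerHeight, lt_min_iff, lt_upperHeight_iff (by positivity), hscale,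
        div_lt_one (by positivity : 0 < M ^ 2), lt_sub_iff_add_lt, ← add_div,
        div_lt_one hM] at h
      exact ⟨h.2.2, by linarith⟩)
  have hcard := Finset.card_filter_add_card_filter_not
    (s := ({p ∈ Finset.Icc 1 ⌊M⌋₊ ×ˢ Finset.Icc 1 ⌊M⌋₊ | r * p.1 * p.2 < M ^ 2} :
      Finset (ℕ × ℕ))) (fun p => M < (p.1 : ℝ) + p.2)
  rw [Finset.filter_filter, Finset.filter_filter] at hcard
  have hT : ({p ∈ Finset.Icc 1 ⌊M⌋₊ ×ˢ Finset.Icc 1 ⌊M⌋₊ |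
      r * p.1 * p.2 < M ^ 2 ∧ M < (p.1 : ℝ) + p.2} : Finset (ℕ × ℕ)) = trianglePairs r M := by
    simp only [trianglePairs, and_comm]
  rw [hT] at hcard
  rw [← hcard] at hU
  push_cast at hU
  rw [triangleArea_eq]
  rw [abs_le] at *
  constructor <;> nlinarith

lemma tendsto_card_trianglePairs {r : ℝ} (hr : 0 ≤ r) :
    Tendsto (fun M : ℝ => ((trianglePairs r M).card : ℝ) / M ^ 2) atTop
      (𝓝 (triangleArea r / 2)) := by
  rw [tendsto_iff_norm_sub_tendsto_zero]
  have h6 : Tendsto (fun M : ℝ => 6 * M⁻¹) atTop (𝓝 0) := by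
    simpa using tendsto_inv_atTop_zero.const_mul (6 : ℝ)
  refine tendsto_of_tendsto_of_tendsto_of_le_of_le' tendsto_const_nhds h6
    (Eventually.of_forall fun _ => norm_nonneg _) ?_
  filter_upwards [eventually_gt_atTop 0] with M hM
  have h := abs_card_trianglePairs_sub_le hr hM
  have e : ((trianglePairs r M).card : ℝ) / M ^ 2 - triangleArea r / 2 =
      (((trianglePairs r M).card : ℝ) - M ^ 2 * (triangleArea r / 2)) / M ^ 2 := by
    field_simp
  rw [e, Real.norm_eq_abs, abs_div, abs_of_pos (show 0 < M ^ 2 by positivity),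
    div_le_iff₀ (by positivity)]
  calc _ ≤ 6 * M := h
    _ = 6 * M⁻¹ * M ^ 2 := by field_simp

/-! ### Möbius inversion and the limiting gap distribution -/

lemma card_trianglePairs_le (r : ℝ) {M : ℝ} (hM : 0 ≤ M) :
    ((trianglePairs r M).card : ℝ) ≤ M ^ 2 := by
  classical
  have h : (trianglePairs r M).card ≤ ⌊M⌋₊ * ⌊M⌋₊ := by
    refine (Finset.card_filter_le _ _).trans ?_
    simp
  have h2 := Nat.floor_le hM
  calc ((trianglePairs r M).card : ℝ) ≤ ⌊M⌋₊ * ⌊M⌋₊ := by exact_mod_cast h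
    _ ≤ M * M := mul_self_le_mul_self (by positivity) h2
    _ = M ^ 2 := (sq M).symm

-- Dividing both coordinates by `d` rescales the region from `N` to `N / d`; this is why
-- `trianglePairs` takes a real scale.
open Classical in
lemma card_filter_dvd_trianglePairs (r : ℝ) (N : ℕ) {d : ℕ} (hd : 0 < d) :
    ({p ∈ trianglePairs r N | d ∣ p.1 ∧ d ∣ p.2} : Finset (ℕ × ℕ)).card =
      (trianglePairs r (N / d)).card := by
  have hdR : (0 : ℝ) < d := by exact_mod_cast hd
  symm
  refine Finset.card_nbij (fun p => (d * p.1, d * p.2)) ?_ ?_ ?_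
  · rintro ⟨a, b⟩ h
    simp only [Finset.mem_coe, Finset.mem_filter, mem_trianglePairs,
      Nat.floor_natCast, Nat.floor_div_eq_div, Nat.le_div_iff_mul_le hd, div_pow] at h ⊢
    obtain ⟨⟨⟨ha, haN⟩, hb, hbN⟩, h1, h2⟩ := h
    rw [div_lt_iff₀ hdR] at h1
    rw [lt_div_iff₀ (by positivity)] at h2
    push_cast
    exact ⟨⟨⟨⟨Nat.mul_pos hd ha, by linarith⟩, Nat.mul_pos hd hb, by linarith⟩, by linarith,
      by linarith⟩, dvd_mul_right _ _, dvd_mul_right _ _⟩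
  · rintro ⟨a, b⟩ - ⟨a', b'⟩ - h
    obtain ⟨h1, h2⟩ := Prod.mk.inj h
    exact Prod.ext (Nat.eq_of_mul_eq_mul_left hd h1) (Nat.eq_of_mul_eq_mul_left hd h2)
  · rintro ⟨x, y⟩ h
    simp only [Finset.mem_coe, Finset.mem_filter, mem_trianglePairs, Nat.floor_natCast] at h
    obtain ⟨⟨⟨⟨ha, haN⟩, hb, hbN⟩, h1, h2⟩, ⟨a, rfl⟩, b, rfl⟩ := h
    refine ⟨(a, b), ?_, rfl⟩
    simp only [Finset.mem_coe, mem_trianglePairs, Nat.floor_div_eq_div,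
      Nat.le_div_iff_mul_le hd, div_pow]
    push_cast at h1 h2
    rw [div_lt_iff₀ hdR, lt_div_iff₀ (by positivity)]
    exact ⟨⟨⟨Nat.pos_of_mul_pos_left ha, by linarith⟩, Nat.pos_of_mul_pos_left hb, by linarith⟩,
      by linarith, by linarith⟩

lemma sum_moebius_divisors (n : ℕ) :
    ∑ d ∈ n.divisors, ArithmeticFunction.moebius d = if n = 1 then 1 else 0 := by
  rw [← ArithmeticFunction.coe_mul_zeta_apply, ArithmeticFunction.moebius_mul_coe_zeta,
    ArithmeticFunction.one_apply]

lemma card_coprimePairs (N : ℕ) (r : ℝ) :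
    ((coprimePairs N r).card : ℤ) =
      ∑ d ∈ Finset.Icc 1 N, ArithmeticFunction.moebius d * (trianglePairs r (N / d)).card := by
  classical
  have hco : coprimePairs N r =
      ({p ∈ trianglePairs r N | p.1.gcd p.2 = 1} : Finset (ℕ × ℕ)) := by
    ext ⟨a, b⟩
    rw [mem_coprimePairs, Finset.mem_filter, mem_trianglePairs, Nat.floor_natCast]
    simp only [Nat.Coprime]
    tauto
  have hdiv : ∀ p ∈ trianglePairs r N, (p.1.gcd p.2).divisors =
      ({d ∈ Finset.Icc 1 N | d ∣ p.1 ∧ d ∣ p.2} : Finset ℕ) := by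
    rintro ⟨a, b⟩ h
    rw [mem_trianglePairs, Nat.floor_natCast] at h
    ext d
    rw [Nat.mem_divisors, Finset.mem_filter, Finset.mem_Icc, Nat.dvd_gcd_iff]
    constructor
    · rintro ⟨⟨ha, hb⟩, -⟩
      exact ⟨⟨Nat.pos_of_dvd_of_pos ha h.1.1.1, (Nat.le_of_dvd h.1.1.1 ha).trans h.1.1.2⟩, ha, hb⟩
    · rintro ⟨-, hd⟩
      exact ⟨hd, (Nat.gcd_pos_of_pos_left b h.1.1.1).ne'⟩
  rw [hco, Finset.card_filter, Nat.cast_sum]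
  calc ∑ p ∈ trianglePairs r N, (((if p.1.gcd p.2 = 1 then 1 else 0 : ℕ)) : ℤ)
      = ∑ p ∈ trianglePairs r N, ∑ d ∈ Finset.Icc 1 N,
          if d ∣ p.1 ∧ d ∣ p.2 then ArithmeticFunction.moebius d else 0 := by
        refine Finset.sum_congr rfl fun p hp => ?_
        rw [← Finset.sum_filter, ← hdiv p hp, sum_moebius_divisors]
        push_cast
        rfl
    _ = _ := by
        rw [Finset.sum_comm]
        refine Finset.sum_congr rfl fun d hd => ?_
        rw [← card_filter_dvd_trianglePairs r N (Finset.mem_Icc.1 hd).1, ← Finset.sum_filter,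
          Finset.sum_const, nsmul_eq_mul, mul_comm]

lemma summable_one_div_sq : Summable fun d : ℕ => 1 / (d : ℝ) ^ 2 :=
  Real.summable_one_div_nat_pow.2 one_lt_two

lemma abs_moebius_le_one' (d : ℕ) : |(ArithmeticFunction.moebius d : ℝ)| ≤ 1 := by
  exact_mod_cast ArithmeticFunction.abs_moebius_le_one (n := d)

/-- The product with `ζ(2)` is `1`. Only nonvanishing matters, since the constant cancels in the gap
proportion. -/
lemma tsum_moebius_div_sq_ne_zero :
    ∑' d : ℕ, (ArithmeticFunction.moebius d : ℝ) / (d : ℝ) ^ 2 ≠ 0 := by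
  intro h
  have h2 : (1 : ℝ) < (2 : ℂ).re := by norm_num
  have hmul := ArithmeticFunction.LSeries_zeta_mul_Lseries_moebius h2
  have hL : LSeries (fun n => ((ArithmeticFunction.moebius n : ℤ) : ℂ)) 2 =
      ((∑' d : ℕ, (ArithmeticFunction.moebius d : ℝ) / (d : ℝ) ^ 2 : ℝ) : ℂ) := by
    rw [LSeries, Complex.ofReal_tsum]
    refine tsum_congr fun n => ?_
    rcases eq_or_ne n 0 with rfl | hn
    · simp
    · rw [LSeries.term_of_ne_zero hn]
      norm_num
  rw [hL, h] at hmul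
  simp at hmul

lemma card_coprimePairs_div_sq (N : ℕ) (r : ℝ) :
    ((coprimePairs N r).card : ℝ) / (N : ℝ) ^ 2 =
      ∑' d : ℕ, (ArithmeticFunction.moebius d : ℝ) *
        (((trianglePairs r (N / d)).card : ℝ) / (N : ℝ) ^ 2) := by
  have h : ((coprimePairs N r).card : ℝ) = ∑ d ∈ Finset.Icc 1 N,
      (ArithmeticFunction.moebius d : ℝ) * (trianglePairs r (N / d)).card := by
    exact_mod_cast card_coprimePairs N r
  rw [tsum_eq_sum (s := Finset.Icc 1 N), h, Finset.sum_div]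
  · exact Finset.sum_congr rfl fun d _ => mul_div_assoc _ _ _
  · intro d hd
    rcases Nat.eq_zero_or_pos d with rfl | hd0
    · simp
    · have hdN : N < d := by
        by_contra hc
        exact hd (Finset.mem_Icc.2 ⟨hd0, not_lt.1 hc⟩)
      have : trianglePairs r (N / d) = ∅ := by
        rw [trianglePairs, Nat.floor_div_eq_div, Nat.div_eq_of_lt hdN]
        simp
      rw [this]; simp

lemma tendsto_card_coprimePairs {r : ℝ} (hr : 0 ≤ r) :
    Tendsto (fun N : ℕ => ((coprimePairs N r).card : ℝ) / (N : ℝ) ^ 2) atTop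
      (𝓝 (triangleArea r / 2 * ∑' d : ℕ, (ArithmeticFunction.moebius d : ℝ) / (d : ℝ) ^ 2)) := by
  have key : Tendsto (fun N : ℕ => ∑' d : ℕ, (ArithmeticFunction.moebius d : ℝ) *
        (((trianglePairs r (N / d)).card : ℝ) / (N : ℝ) ^ 2)) atTop
      (𝓝 (∑' d : ℕ, (ArithmeticFunction.moebius d : ℝ) *
        (triangleArea r / 2 * (1 / (d : ℝ) ^ 2)))) := by
    -- The trivial count, at most `(N/d)²` pairs, bounds the `d`-th term by `1/d²` uniformly in `N`.
    refine tendsto_tsum_of_dominated_convergence summable_one_div_sq (fun d => ?_) ?_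
    · rcases Nat.eq_zero_or_pos d with rfl | hd
      · simp
      · have hdR : (0 : ℝ) < d := by exact_mod_cast hd
        have h := ((tendsto_card_trianglePairs hr).comp
          ((tendsto_natCast_atTop_atTop (R := ℝ)).atTop_div_const hdR)).mul_const
            (1 / (d : ℝ) ^ 2)
        refine (h.congr' ?_).const_mul _
        filter_upwards with N
        simp only [Function.comp_apply]
        field_simp
    · filter_upwards [eventually_gt_atTop 0] with N hN d
      have hNR : (0 : ℝ) < N := by exact_mod_cast hN
      rw [norm_mul, Real.norm_eq_abs, Real.norm_eq_abs]
      refine (mul_le_of_le_one_left (abs_nonneg _) (abs_moebius_le_one' d)).trans ?_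
      rw [abs_of_nonneg (by positivity), div_le_iff₀ (by positivity)]
      refine (card_trianglePairs_le r (by positivity)).trans (le_of_eq ?_)
      rw [div_pow]; ring
  rw [← tsum_mul_left]
  refine (key.congr' ?_).trans (le_of_eq ?_)
  · filter_upwards with N using (card_coprimePairs_div_sq N r).symm
  · congr 1
    exact tsum_congr fun d => by ring

lemma tendsto_fareyGapTail {r : ℝ} (hr : 0 ≤ r) :
    Tendsto (fun N : ℕ => fareyGapTail N r) atTop (𝓝 (triangleArea r)) := by
  have hZ := tsum_moebius_div_sq_ne_zero
  set Z := ∑' d : ℕ, (ArithmeticFunction.moebius d : ℝ) / (d : ℝ) ^ 2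
  -- At `r = 0` the hyperbola condition is void: this counts all gaps, and the normalised area is
  -- `1`.
  have h0 := tendsto_card_coprimePairs le_rfl
  rw [triangleArea_of_le_one zero_le_one] at h0
  have h := (tendsto_card_coprimePairs hr).div h0 (mul_ne_zero (by norm_num) hZ)
  have hlim : triangleArea r / 2 * Z / (1 / 2 * Z) = triangleArea r := by field_simp
  rw [hlim] at h
  refine h.congr' ?_
  filter_upwards [eventually_gt_atTop 0] with N hN
  have hNR : (N : ℝ) ^ 2 ≠ 0 := by positivity
  rw [fareyGapTail_eq hN, Pi.div_apply, div_div_div_cancel_right₀ hNR]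

end ModularHorocycle

theorem mainTheorem11 :
    (∀ r : ℝ, 0 ≤ r → r < 1 →
      ModularHorocycle.hittingDensity r = 3 / Real.pi ^ 2) ∧
    (∀ r : ℝ, 1 ≤ r → r ≤ 4 →
      ModularHorocycle.hittingDensity r
        = 3 / Real.pi ^ 2 * (-1 + 2 * r⁻¹ + 2 * r⁻¹ * Real.log r)) ∧
    (∀ r : ℝ, 4 ≤ r →
      ModularHorocycle.hittingDensity r
        = 3 / Real.pi ^ 2 * (-1 + 2 * r⁻¹ + 2 * Real.sqrt (1 / 4 - r⁻¹)
            - 4 * r⁻¹ * Real.log (1 / 2 + Real.sqrt (1 / 4 - r⁻¹)))) ∧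
    (ModularHorocycle.hittingDensity ~[atTop] fun r : ℝ => 6 / Real.pi ^ 2 * (r ^ 2)⁻¹) ∧
    (∀ r : ℝ, 0 ≤ r →
      Tendsto (fun N : ℕ => ModularHorocycle.fareyGapTail N r) atTop
        (𝓝 (Real.pi ^ 2 / 3 * ModularHorocycle.hittingDensity r))) ∧
    (∀ s : ℝ, s ≤ -2 * Real.log 2 →
      ModularHorocycle.extremeDensity s
        = 3 / Real.pi ^ 2 * (-Real.exp (-s) + 2
            + 2 * Real.exp (-s) * Real.sqrt (1 / 4 - Real.exp s)
            - 4 * Real.log (1 / 2 + Real.sqrt (1 / 4 - Real.exp s)))) ∧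
    (∀ s : ℝ, -2 * Real.log 2 ≤ s → s ≤ 0 →
      ModularHorocycle.extremeDensity s
        = 3 / Real.pi ^ 2 * (-Real.exp (-s) + 2 - 2 * s)) ∧
    (∀ s : ℝ, 0 ≤ s →
      ModularHorocycle.extremeDensity s = 3 / Real.pi ^ 2 * Real.exp (-s)) ∧
    (ModularHorocycle.extremeDensity ~[atBot]
      fun s : ℝ => 6 / Real.pi ^ 2 * Real.exp (-|s|)) := by
  refine ⟨fun r _ hr1 => ?_, fun r hr1 hr4 => ?_, fun r hr4 => ?_,
    ModularHorocycle.hittingDensity_isEquivalent, fun r hr => ?_, fun s hs => ?_,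
    fun s hs hs0 => ?_, fun s hs => ?_, ModularHorocycle.extremeDensity_isEquivalent⟩
  · rw [ModularHorocycle.hittingDensity_eq,
      ModularHorocycle.triangleArea_of_le_one hr1.le, mul_one]
  · rw [ModularHorocycle.hittingDensity_eq, ModularHorocycle.triangleArea_of_le_four hr1 hr4]
  · rw [ModularHorocycle.hittingDensity_eq, ModularHorocycle.triangleArea_of_four_le hr4]
  · have hpi : Real.pi ^ 2 / 3 * ModularHorocycle.hittingDensity r =
        ModularHorocycle.triangleArea r := by
      have := Real.pi_pos
      rw [ModularHorocycle.hittingDensity_eq]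
      field_simp
    rw [hpi]
    exact ModularHorocycle.tendsto_fareyGapTail hr
  · have h4 : 4 ≤ Real.exp (-s) := by
      rw [← Real.log_le_iff_le_exp (by norm_num), show (4 : ℝ) = 2 ^ 2 by norm_num, Real.log_pow]
      push_cast
      linarith
    rw [ModularHorocycle.extremeDensity, ModularHorocycle.hittingDensity_eq,
      ModularHorocycle.triangleArea_of_four_le h4, Real.exp_neg, inv_inv]
    field_simp
  · have h1 : 1 ≤ Real.exp (-s) := Real.one_le_exp (by linarith)
    have h4 : Real.exp (-s) ≤ 4 := by
      rw [← Real.le_log_iff_exp_le (by norm_num), show (4 : ℝ) = 2 ^ 2 by norm_num, Real.log_pow]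
      push_cast
      linarith
    rw [ModularHorocycle.extremeDensity, ModularHorocycle.hittingDensity_eq,
      ModularHorocycle.triangleArea_of_le_four h1 h4, Real.log_exp, Real.exp_neg, inv_inv]
    field_simp
    ring
  · rw [ModularHorocycle.extremeDensity, ModularHorocycle.hittingDensity_eq,
      ModularHorocycle.triangleArea_of_le_one (Real.exp_le_one_iff.2 (by linarith))]
    ring
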